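/- For $L>0$ let $\mathcal F_L$ be the set of $L$-Lipschitz functions $f:[0,1]\to[0,1]$. For a probability distribution $\mathcal D$ on $[0,1]\times[0,1]$ put $\mathrm{err}_{\mathcal D}(f)=\mathbb E_{(x,y)\sim\mathcal D}|y-f(x)|$ and $\mathrm{err}_{\mathcal D}(\mathcal F_L)=\min_{f\in\mathcal F_L}\mathrm{err}_{\mathcal D}(f)$. For a finite labeled sample $T$ let $\hat f_T\in\mathcal F_L$ be a minimizer of $\sum_{(x,y)\in T}|y-f(x)|$ over $f\in\mathcal F_L$, with ties broken by any fixed measurable rule. Algorithm $\mathrm{Error}(L,\mathcal D,\eta)$, $0<\eta\le 1$, with pool size $M$ and fresh sample size $N$, works as follows. *Preprocess.* Choose $j$ uniformly from the integers in $[1,1/\eta]$. Put $b_0=0$, $b_1=j/L$, $b_2=b_1+\frac1L$, $b_3=b_2+\frac1{L\eta}$, $b_4=b_3+\frac1L$, and so on alternately, and let $I_i=[b_{i-1},b_i]$ for those $i$ with $b_{i-1}<1$ (cut off at $1$). $I_i$ is called long for odd $i$ and short for even $i$. Draw a pool $S$ of $M$ i.i.d. unlabeled samples from the marginal $\mathcal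 D_x$; the label of a pool point is fixed and is revealed when it is queried. If a long interval gets more than $\frac1{2\eta^4}\log\frac1\eta$ samples, the samples that fall into it afterwards are discarded. *Query$(x)$.* If $x$ lies in a long interval $I_i$, query the labels of $S\cap I_i$ and output $\hat f_{S\cap I_i}(x)$. Otherwise $x$ lies in a short interval $I_i$; query the labels of $S\cap(I_{i-1}\cup I_{i+1})$ and output $v^l+(x-b_{i-1})\frac{v^u-v^l}{b_i-b_{i-1}}$, where $v^l=\hat f_{S\cap I_{i-1}}(b_{i-1})$ and $v^u=\hat f_{S\cap I_{i+1}}(b_i)$ (if $b_i\ge1$, so that $I_{i+1}$ does not exist, $v^u=v^l$). *Output.* Draw $N$ fresh i.i.d. labeled samples $(x_1,y_1),\dots,(x_N,y_N)$ from $\mathcal D$ and output $\widehat{\mathrm{err}}=\frac1N\sum_{i=1}^N|\mathrm{Query}(x_i)-y_i|$. **Theorem.** There are absolute constants $c\in(0,1]$ and $C>0$ such that for all $L>0$ and $\epsilon\in(0,1]$ there are sizes $$M\le C\,\frac{\max\{L,\epsilon\}}{\epsilon^4}\log\frac2\epsilon,\qquad N\le\frac{C}{\epsilon^2},$$ for which,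 for every tie-breaking rule, $\mathrm{Error}(L,\mathcal D,c\epsilon)$ always uses at most $\frac{C}{\epsilon^6}\log\frac2\epsilon$ labels (label queries to the pool and labels of the fresh samples together), and, for every distribution $\mathcal D$ on $[0,1]\times[0,1]$, $$\Pr\Bigl[\,\bigl|\widehat{\mathrm{err}}-\mathrm{err}_{\mathcal D}(\mathcal F_L)\bigr|\le\epsilon\Bigr]\ge\frac12 .$$ In particular, for $\epsilon\le\min\{L,\frac12\}$ the algorithm uses $O(\frac1{\epsilon^6}\log\frac1\epsilon)$ label queries on $O(\frac L{\epsilon^4}\log\frac1\epsilon)$ unlabeled samples. -/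

import Mathlib

open MeasureTheory

namespace LipschitzError

/-- A labelled example `(x, y)`, with `x` and `y` in `[0,1]`. -/
abbrev Example : Type := unitInterval × unitInterval

/-! ### The function class and the prediction errors -/

/-- `F_L`: the `L`-Lipschitz functions from `[0,1]` to `[0,1]`. -/
def lipClass (L : ℝ) : Set (unitInterval → unitInterval) :=
  {f | LipschitzWith L.toNNReal f}

/-- `err_D(f) = E_{(x,y) ~ D} |y - f x|`. -/
noncomputable def err (D : Measure Example) (f : unitInterval → unitInterval) : ℝ :=
  ∫ z, |(z.2 : ℝ) - (f z.1 : ℝ)| ∂D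

/-- `err_D(F_L)`, the optimal prediction error of the class. -/
noncomputable def optErr (D : Measure Example) (L : ℝ) : ℝ :=
  sInf (err D '' lipClass L)

/-- The (unnormalised) empirical absolute error of `f` on a finite labelled sample. -/
noncomputable def empErr (s : List Example) (f : unitInterval → unitInterval) : ℝ :=
  (s.map fun z => |(z.2 : ℝ) - (f z.1 : ℝ)|).sum

/-- `fhat` is an empirical risk minimisation rule for `F_L`: on every finite labelled sample `s`
it returns a minimiser over `F_L` of the empirical error on `s`.  Ties are broken in an arbitrary
way that is measurable in the sample and the evaluation point. -/
structure IsERMRule (L : ℝ) (fhat : List Example → unitInterval → unitInterval) : Prop where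
  mem : ∀ s, fhat s ∈ lipClass L
  min : ∀ s, ∀ g ∈ lipClass L, empErr s (fhat s) ≤ empErr s g
  meas : ∀ n : ℕ, Measurable fun p : (Fin n → Example) × unitInterval =>
    fhat (List.ofFn p.1) p.2

/-! ### Algorithms with access to a label oracle -/

/-- An adaptive algorithm with a label oracle for a pool of `M` points: it either stops with an
output, or asks for the label of the `j`-th pool point and continues depending on the answer. -/
inductive LabelAlg (M : ℕ) (α : Type) : Type
  | output (a : α) : LabelAlg M α
  | ask (j : Fin M) (next : unitInterval → LabelAlg M α) : LabelAlg M α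

namespace LabelAlg

variable {M : ℕ} {α β : Type}

/-- Run `p`, then continue with its output. -/
def bind (p : LabelAlg M α) (k : α → LabelAlg M β) : LabelAlg M β :=
  match p with
  | output a => k a
  | ask j next => ask j fun y => (next y).bind k

/-- The output when the labels of the pool are `y`. -/
def result (y : Fin M → unitInterval) : LabelAlg M α → α
  | output a => a
  | ask j next => (next (y j)).result y

/-- The number of label queries made when the labels of the pool are `y`. Repeated queries of the
same label are counted each time. -/
def queryCount (y : Fin M → unitInterval) : LabelAlg M α → ℕ
  | output _ => 0
  | ask j next => (next (y j)).queryCount y + 1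

/-- Query the labels of the listed pool points; output the list of labelled points. -/
def askAll (xs : Fin M → unitInterval) : List (Fin M) → LabelAlg M (List Example)
  | [] => output []
  | j :: js => ask j fun y => (askAll xs js).bind fun l => output ((xs j, y) :: l)

/-- Run a list of algorithms one after the other; output the sum of their outputs. -/
noncomputable def sumAll : List (LabelAlg M ℝ) → LabelAlg M ℝ
  | [] => output 0
  | p :: ps => p.bind fun v => (sumAll ps).bind fun w => output (v + w)

end LabelAlg

/-! ### The partition -/

/-- The breakpoints `b 0 = 0`, `b 1 = j / L`, `b 2 = b 1 + 1 / L`, `b 3 = b 2 + 1 / (L ε)`, ... .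
The long intervals are `[b (2 m), b (2 m + 1)]`, the short ones `[b (2 m + 1), b (2 m + 2)]`; the
partition of `[0,1]` consists of the intervals whose left end is `< 1`, cut off at `1`. -/
noncomputable def breakpoint (L ε : ℝ) (j : ℕ) : ℕ → ℝ
  | 0 => 0
  | 1 => j / L
  | i + 2 => breakpoint L ε j (i + 1) + (if Even i then 1 / L else 1 / (L * ε))

/-- `x` lies in the `m`-th long interval of the partition. -/
def InLong (L ε : ℝ) (j m : ℕ) (x : unitInterval) : Prop :=
  breakpoint L ε j (2 * m) < 1 ∧
    (x : ℝ) ∈ Set.Icc (breakpoint L ε j (2 * m)) (breakpoint L ε j (2 * m + 1))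

/-- `x` lies in the `m`-th short interval of the partition. -/
def InShort (L ε : ℝ) (j m : ℕ) (x : unitInterval) : Prop :=
  breakpoint L ε j (2 * m + 1) < 1 ∧
    (x : ℝ) ∈ Set.Icc (breakpoint L ε j (2 * m + 1)) (breakpoint L ε j (2 * m + 2))

/-! ### Local queries -/

section Algorithms

variable {M : ℕ} (fhat : List Example → unitInterval → unitInterval) (L ε : ℝ) (j : ℕ)
  (xs : Fin M → unitInterval)

open Classical in
/-- The pool points in the `m`-th long interval, in order of arrival. As soon as there are more
than `(1 / (2 ε ^ 4)) log (1 / ε)` of them, later ones are discarded. -/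
noncomputable def poolIn (m : ℕ) : List (Fin M) :=
  ((List.finRange M).filter fun i => decide (InLong L ε j m (xs i))).take
    (⌊1 / (2 * ε ^ 4) * Real.log (1 / ε)⌋₊ + 1)

/-- Query the labels of the pool points in the `m`-th long interval; output the empirical risk
minimiser on them. -/
noncomputable def learn (m : ℕ) : LabelAlg M (unitInterval → unitInterval) :=
  (LabelAlg.askAll xs (poolIn L ε j xs m)).bind fun s => .output (fhat s)

/-- The value of `f : [0,1] → [0,1]` at a real number `b` that lies in `[0,1]`. -/
noncomputable def evalAt (f : unitInterval → unitInterval) (b : ℝ) : ℝ :=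
  (f (Set.projIcc 0 1 zero_le_one b) : ℝ)

open Classical in
/-- The local query at `x`. In a long interval, it is the value of the empirical risk minimiser on
that interval. In a short interval, it interpolates linearly between the values at the two ends of
the minimisers on the two neighbouring long intervals; if the short interval reaches the end of
`[0,1]`, so that it has no right neighbour, the value at its left end is used. (A short interval
always has a left neighbour. The last branch is never reached when `0 < L`, `0 < ε`.) -/
noncomputable def query (x : unitInterval) : LabelAlg M ℝ :=
  if h : ∃ m, InLong L ε j m x then
    (learn fhat L ε j xs (Nat.find h)).bind fun f => .output (f x : ℝ)
  else if h : ∃ m, InShort L ε j m x then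
    let m := Nat.find h
    let bl := breakpoint L ε j (2 * m + 1)
    let br := breakpoint L ε j (2 * m + 2)
    (learn fhat L ε j xs m).bind fun fl =>
      if br < 1 then
        (learn fhat L ε j xs (m + 1)).bind fun fr =>
          .output (evalAt fl bl + ((x : ℝ) - bl) * ((evalAt fr br - evalAt fl bl) / (br - bl)))
      else .output (evalAt fl bl)
  else .output 0

/-- Error estimation from `N` labelled examples: the average of `|query x - y|` over them. -/
noncomputable def errorEstimate {N : ℕ} (fresh : Fin N → Example) : LabelAlg M ℝ :=
  (LabelAlg.sumAll (List.ofFn fun i : Fin N =>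
    (query fhat L ε j xs (fresh i).1).bind fun v =>
      .output |v - ((fresh i).2 : ℝ)|)).bind fun t => .output (1 / (N : ℝ) * t)

end Algorithms

/-! ### The randomness of the algorithm -/

/-- An outcome of all random choices: the offset `j`, the pool of `M` examples (of which
the labels are only accessible through label queries), and the `N` fresh labelled examples. -/
abbrev Outcome (M N : ℕ) : Type := ℕ × (Fin M → Example) × (Fin N → Example)

/-- The offset is uniform on the integers `j` with `1 ≤ j ≤ 1 / ε`; the pool and the fresh examples
are i.i.d. from `D`; everything is independent. -/
noncomputable def outcomeMeasure (D : Measure Example) (ε : ℝ) (M N : ℕ) :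
    Measure (Outcome M N) :=
  (ProbabilityTheory.uniformOn (Set.Icc 1 ⌊1 / ε⌋₊)).prod
    ((Measure.pi fun _ : Fin M => D).prod (Measure.pi fun _ : Fin N => D))

/-- The algorithm `Error` (with Lipschitz constant `L` and accuracy parameter `ε`) for given random
choices, as an algorithm that may query the labels of the pool. -/
noncomputable def errorAlg (fhat : List Example → unitInterval → unitInterval) (L ε : ℝ)
    {M N : ℕ} (w : Outcome M N) : LabelAlg M ℝ :=
  errorEstimate fhat L ε w.1 (fun i => (w.2.1 i).1) w.2.2

/-- The output of `Error`: the estimate of `err_D(F_L)`. -/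
noncomputable def errorOutput (fhat : List Example → unitInterval → unitInterval) (L ε : ℝ)
    {M N : ℕ} (w : Outcome M N) : ℝ :=
  (errorAlg fhat L ε w).result fun i => (w.2.1 i).2

/-- The number of labels used by `Error`: the label queries to the pool, and the labels of the `N`
fresh examples. -/
noncomputable def errorLabels (fhat : List Example → unitInterval → unitInterval) (L ε : ℝ)
    {M N : ℕ} (w : Outcome M N) : ℕ :=
  (errorAlg fhat L ε w).queryCount (fun i => (w.2.1 i).2) + N

end LipschitzError

open MeasureTheory

namespace LipschitzError

/-! ### What the algorithm computes and how many labels it uses -/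

namespace LabelAlg

variable {M : ℕ} {α β : Type}

/-! Write η for the accuracy parameter `c * ε`. For a fixed offset and pool, the local queries
evaluate one fixed function `queryFun`. It is L-Lipschitz (`queryFun_mem_lipClass`): each long
interval carries a member of the class, and each short interval has length 1/L, enough for linear
interpolation between two values in [0,1]. Hence its error is at least the optimum. It remains to
bound its excess error and to see that the fresh sample estimates its error well, which is
Hoeffding's inequality for a single function (`measure_fresh_deviation_le`).

The excess over a competitor splits over the partition (`err_queryFun_sub_le`). On a long interval
it is the excess of a local empirical risk minimiser. A strip of width at most 1/(Lη) has a finite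
cover by step functions, so uniform convergence makes this excess at most 20η times the mass of the
interval, except with probability 2η, provided the interval is not too light
(`measure_badPools_le`). There are at most about Lη + 2 long intervals, so those of mass below η/(Lη
+ 2) contribute at most η in total. The expected mass of the remaining intervals on which learning
fails is at most 2η (`integral_randomExcess_le`).

Off the long intervals the loss difference is bounded by 1, and the mass there is small on average
over the offset: different offsets leave disjoint sets uncovered (`offset_unique`), so these masses
sum to at most 1 and average to at most 2η. Markov's inequality over the pool, averaged over the
offset, concludes (`half_le_measure_success`).

The number of pool points kept in an interval is random and capped. Instead of conditioning on it,
the concentration bounds use the exponential moment of the sum over the kept points, by induction on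
the sample size (`lintegral_prod_kept_le`). Only the failure event's outer measure is bounded, so
measurability is needed just for the fresh-sample estimate. -/

theorem result_bind (y : Fin M → unitInterval) (p : LabelAlg M α) (k : α → LabelAlg M β) :
    (p.bind k).result y = (k (p.result y)).result y := by
  induction p with
  | output a => rfl
  | ask j next ih => simpa [bind, result] using ih (y j)

theorem queryCount_bind (y : Fin M → unitInterval) (p : LabelAlg M α) (k : α → LabelAlg M β) :
    (p.bind k).queryCount y = p.queryCount y + (k (p.result y)).queryCount y := by
  induction p with
  | output a => simp [bind, result, queryCount]
  | ask j next ih => simp [bind, result, queryCount, ih (y j)]; ring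

theorem result_askAll (xs y : Fin M → unitInterval) (js : List (Fin M)) :
    (askAll xs js).result y = js.map fun j => (xs j, y j) := by
  induction js with
  | nil => rfl
  | cons j js ih => simp [askAll, result, result_bind, ih]

theorem queryCount_askAll (xs y : Fin M → unitInterval) (js : List (Fin M)) :
    (askAll xs js).queryCount y = js.length := by
  induction js with
  | nil => rfl
  | cons j js ih => simp [askAll, queryCount, queryCount_bind, ih]

theorem result_sumAll (y : Fin M → unitInterval) (ps : List (LabelAlg M ℝ)) :
    (sumAll ps).result y = (ps.map (result y)).sum := by
  induction ps with
  | nil => rfl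
  | cons p ps ih => simp [sumAll, result, result_bind, ih]

theorem queryCount_sumAll_le (y : Fin M → unitInterval) (ps : List (LabelAlg M ℝ)) (k : ℕ)
    (h : ∀ p ∈ ps, p.queryCount y ≤ k) : (sumAll ps).queryCount y ≤ ps.length * k := by
  induction ps with
  | nil => simp [sumAll, queryCount]
  | cons p ps ih =>
    have h1 := h p (by simp)
    have h2 := ih fun q hq => h q (by simp [hq])
    simp only [sumAll, queryCount, queryCount_bind, List.length_cons, add_mul, one_mul]
    omega

end LabelAlg

section Semantics

variable {M N : ℕ} (fhat : List Example → unitInterval → unitInterval) (L η : ℝ) (j : ℕ)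
  (S : Fin M → Example)

/-- The cap on the number of pool points that are kept in a long interval. -/
noncomputable def cap (η : ℝ) : ℕ := ⌊1 / (2 * η ^ 4) * Real.log (1 / η)⌋₊ + 1

/-- The labelled pool points on which the minimiser of the `m`-th long interval is based. -/
noncomputable def poolExamples (m : ℕ) : List Example :=
  (poolIn L η j (fun i => (S i).1) m).map S

/-- The empirical risk minimiser on the `m`-th long interval. -/
noncomputable def localMin (m : ℕ) : unitInterval → unitInterval :=
  fhat (poolExamples L η j S m)

/-- The output of the local query at `x`, when `S` is the labelled pool. -/
noncomputable def queryValue (x : unitInterval) : ℝ :=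
  (query fhat L η j (fun i => (S i).1) x).result fun i => (S i).2

/-- The interpolation between the minimisers on the neighbours of the `m`-th short interval. -/
noncomputable def interp (m : ℕ) (x : unitInterval) : ℝ :=
  let bl := breakpoint L η j (2 * m + 1)
  let br := breakpoint L η j (2 * m + 2)
  let vl := evalAt (localMin fhat L η j S m) bl
  if br < 1 then
    vl + ((x : ℝ) - bl) * ((evalAt (localMin fhat L η j S (m + 1)) br - vl) / (br - bl))
  else vl

theorem result_learn (m : ℕ) :
    (learn fhat L η j (fun i => (S i).1) m).result (fun i => (S i).2) =
      localMin fhat L η j S m := by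
  simp [learn, LabelAlg.result_bind, LabelAlg.result_askAll, LabelAlg.result, localMin,
    poolExamples]

theorem length_poolIn_le (xs : Fin M → unitInterval) (m : ℕ) :
    (poolIn L η j xs m).length ≤ cap η := by
  simp only [poolIn, List.length_take, cap]
  exact min_le_left _ _

theorem queryCount_learn_le (xs y : Fin M → unitInterval) (m : ℕ) :
    (learn fhat L η j xs m).queryCount y ≤ cap η := by
  simp only [learn, LabelAlg.queryCount_bind, LabelAlg.queryCount_askAll, LabelAlg.queryCount,
    add_zero]
  exact length_poolIn_le L η j xs m

open Classical in
theorem queryValue_eq (x : unitInterval) :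
    queryValue fhat L η j S x =
      if h : ∃ m, InLong L η j m x then (localMin fhat L η j S (Nat.find h) x : ℝ)
      else if h : ∃ m, InShort L η j m x then interp fhat L η j S (Nat.find h) x
      else 0 := by
  unfold queryValue query
  split_ifs with h1 h2
  · simp [LabelAlg.result_bind, LabelAlg.result, result_learn]
  · simp only [LabelAlg.result_bind, result_learn, interp]
    split_ifs
    · simp [LabelAlg.result_bind, LabelAlg.result, result_learn]
    · simp [LabelAlg.result]
  · rfl

theorem queryCount_query_le (xs y : Fin M → unitInterval) (x : unitInterval) :
    (query fhat L η j xs x).queryCount y ≤ 2 * cap η := by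
  classical
  unfold query
  have h := queryCount_learn_le fhat L η j xs y
  split_ifs with h1 h2
  · have := h (Nat.find h1)
    simp only [LabelAlg.queryCount_bind, LabelAlg.queryCount]
    omega
  · have e1 := h (Nat.find h2)
    have e2 := h (Nat.find h2 + 1)
    simp only [LabelAlg.queryCount_bind]
    split_ifs
    · simp only [LabelAlg.queryCount_bind, LabelAlg.queryCount]
      omega
    · simp only [LabelAlg.queryCount]
      omega
  · simp [LabelAlg.queryCount]

theorem errorOutput_eq (T : Fin N → Example) :
    errorOutput fhat L η (j, S, T) =
      1 / (N : ℝ) * ∑ i, |queryValue fhat L η j S (T i).1 - ((T i).2 : ℝ)| := by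
  simp [errorOutput, errorAlg, errorEstimate, LabelAlg.result_bind, LabelAlg.result,
    LabelAlg.result_sumAll, List.map_ofFn, Function.comp_def, List.sum_ofFn, queryValue]

theorem errorLabels_le (w : Outcome M N) :
    errorLabels fhat L η w ≤ N * (2 * cap η) + N := by
  have h := LabelAlg.queryCount_sumAll_le (fun i => (w.2.1 i).2)
    (List.ofFn fun i : Fin N =>
      (query fhat L η w.1 (fun i => (w.2.1 i).1) (w.2.2 i).1).bind fun v =>
        .output |v - ((w.2.2 i).2 : ℝ)|) (2 * cap η) (by
    intro p hp
    obtain ⟨i, rfl⟩ := (List.mem_ofFn' _ _).1 hp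
    simp only [LabelAlg.queryCount_bind, LabelAlg.queryCount, add_zero]
    exact queryCount_query_le _ _ _ _ _ _ _)
  rw [List.length_ofFn] at h
  simpa [errorLabels, errorAlg, errorEstimate, LabelAlg.queryCount_bind, LabelAlg.queryCount]
    using h

end Semantics

/-! ### Geometry of the partition -/

section Geometry

variable {L η : ℝ} {j : ℕ}

theorem breakpoint_odd (L η : ℝ) (j m : ℕ) :
    breakpoint L η j (2 * m + 1) = j / L + m * (1 / L + 1 / (L * η)) := by
  induction m with
  | zero => simp [breakpoint]
  | succ m ih =>
    have h1 : breakpoint L η j (2 * m + 2) = breakpoint L η j (2 * m + 1) + 1 / L := by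
      simp [breakpoint]
    have h2 : breakpoint L η j (2 * m + 3) = breakpoint L η j (2 * m + 2) + 1 / (L * η) := by
      rw [show 2 * m + 3 = (2 * m + 1) + 2 by ring, breakpoint]
      simp
    rw [show 2 * (m + 1) + 1 = 2 * m + 3 by ring, h2, h1, ih]
    push_cast
    ring

theorem breakpoint_even_succ (L η : ℝ) (j m : ℕ) :
    breakpoint L η j (2 * m + 2) = j / L + m * (1 / L + 1 / (L * η)) + 1 / L := by
  rw [← breakpoint_odd]
  simp [breakpoint]

theorem breakpoint_strictMono (hL : 0 < L) (hη : 0 < η) (hj : 1 ≤ j) :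
    StrictMono (breakpoint L η j) := by
  refine strictMono_nat_of_lt_succ fun i => ?_
  match i with
  | 0 =>
    have : (0 : ℝ) < j := by exact_mod_cast hj
    simp only [breakpoint]
    positivity
  | i + 1 =>
    have h : 0 < (if Even i then 1 / L else 1 / (L * η)) := by split_ifs <;> positivity
    rw [breakpoint]
    linarith

theorem breakpoint_nonneg (hL : 0 < L) (hη : 0 < η) (hj : 1 ≤ j) (i : ℕ) :
    0 ≤ breakpoint L η j i := by
  simpa [breakpoint] using (breakpoint_strictMono hL hη hj).monotone (Nat.zero_le i)

theorem breakpoint_long_length (hL : 0 < L) (hj : (j : ℝ) ≤ 1 / η) (m : ℕ) :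
    breakpoint L η j (2 * m + 1) ≤ breakpoint L η j (2 * m) + 1 / (L * η) := by
  cases m with
  | zero =>
    simp only [breakpoint, zero_add]
    rw [mul_comm L, ← div_div]
    gcongr
  | succ m =>
    rw [breakpoint_odd, show 2 * (m + 1) = 2 * m + 2 by ring, breakpoint_even_succ]
    push_cast
    linarith

/-- Among the m long intervals to the left, all but the initial one have full length 1/(Lη). The
initial one, of length j/L, is not counted, hence m - 1. -/
theorem breakpoint_even_lower (hL : 0 < L) (hη : 0 < η) (m : ℕ) :
    ((m : ℝ) - 1) / (L * η) ≤ breakpoint L η j (2 * m) := by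
  cases m with
  | zero =>
    simp only [breakpoint, CharP.cast_eq_zero, zero_sub]
    apply div_nonpos_of_nonpos_of_nonneg <;> [norm_num; positivity]
  | succ m =>
    rw [show 2 * (m + 1) = 2 * m + 2 by ring, breakpoint_even_succ]
    have h1 : 0 ≤ j / L + m * (1 / L) + 1 / L := by positivity
    have h2 : ((m + 1 : ℕ) - 1 : ℝ) / (L * η) = m * (1 / (L * η)) := by push_cast; ring
    rw [h2]
    linarith

/-- Long intervals only exist for `m < L η + 1`. -/
theorem lt_of_breakpoint_lt_one (hL : 0 < L) (hη : 0 < η) {m : ℕ}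
    (h : breakpoint L η j (2 * m) < 1) : (m : ℝ) < L * η + 1 := by
  have h1 := (breakpoint_even_lower (j := j) hL hη m).trans_lt h
  rw [div_lt_one (by positivity)] at h1
  linarith

theorem exists_le_breakpoint (hL : 0 < L) (hη : 0 < η) (x : ℝ) :
    ∃ i, x ≤ breakpoint L η j (i + 1) := by
  obtain ⟨n, hn⟩ := exists_nat_gt (x * (L * η) + 1)
  refine ⟨2 * n + 1, ?_⟩
  have h := breakpoint_even_lower (j := j) hL hη (n + 1)
  rw [show 2 * (n + 1) = 2 * n + 1 + 1 by ring] at h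
  refine le_trans ?_ h
  rw [le_div_iff₀ (by positivity)]
  push_cast
  linarith

theorem exists_inLong_or_inShort (hL : 0 < L) (hη : 0 < η) (x : unitInterval) :
    (∃ m, InLong L η j m x) ∨ ∃ m, InShort L η j m x := by
  classical
  have hex := exists_le_breakpoint (j := j) hL hη (x : ℝ)
  obtain ⟨i, hi, hmin⟩ : ∃ i, (x : ℝ) ≤ breakpoint L η j (i + 1) ∧
      ∀ k < i, ¬ (x : ℝ) ≤ breakpoint L η j (k + 1) :=
    ⟨Nat.find hex, Nat.find_spec hex, fun k hk => Nat.find_min hex hk⟩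
  have h : breakpoint L η j i < 1 ∧ breakpoint L η j i ≤ x := by
    cases i with
    | zero => exact ⟨by simp [breakpoint], by simpa [breakpoint] using x.2.1⟩
    | succ i =>
      have := hmin i (Nat.lt_succ_self i)
      rw [not_le] at this
      exact ⟨this.trans_le x.2.2, this.le⟩
  rcases Nat.even_or_odd' i with ⟨m, rfl | rfl⟩
  · exact Or.inl ⟨m, h.1, h.2, hi⟩
  · exact Or.inr ⟨m, h.1, h.2, hi⟩

theorem InLong.unique (hL : 0 < L) (hη : 0 < η) (hj : 1 ≤ j) {m m' : ℕ} {x : unitInterval}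
    (h : InLong L η j m x) (h' : InLong L η j m' x) : m = m' := by
  have key : ∀ {a b : ℕ}, InLong L η j a x → InLong L η j b x → ¬ a < b := by
    intro a b ha hb hab
    have := breakpoint_strictMono hL hη hj (show 2 * a + 1 < 2 * b by omega)
    linarith [ha.2.2, hb.2.1]
  have := key h h'
  have := key h' h
  omega

theorem InShort.unique (hL : 0 < L) (hη : 0 < η) (hj : 1 ≤ j) {m m' : ℕ} {x : unitInterval}
    (h : InShort L η j m x) (h' : InShort L η j m' x) : m = m' := by
  have key : ∀ {a b : ℕ}, InShort L η j a x → InShort L η j b x → ¬ a < b := by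
    intro a b ha hb hab
    have := breakpoint_strictMono hL hη hj (show 2 * a + 2 < 2 * b + 1 by omega)
    linarith [ha.2.2, hb.2.1]
  have := key h h'
  have := key h' h
  omega

/-- A point of a short interval that also lies in a long one is a common end point. -/
theorem InShort.eq_breakpoint (hL : 0 < L) (hη : 0 < η) (hj : 1 ≤ j) {m m' : ℕ}
    {x : unitInterval} (h : InShort L η j m x) (h' : InLong L η j m' x) :
    (m' = m ∧ (x : ℝ) = breakpoint L η j (2 * m + 1)) ∨
      (m' = m + 1 ∧ (x : ℝ) = breakpoint L η j (2 * m + 2)) := by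
  have hmono := breakpoint_strictMono hL hη hj
  have e1 : ¬ 2 * m' + 1 < 2 * m + 1 := fun hlt => by
    linarith [hmono hlt, h.2.1, h'.2.2]
  have e2 : ¬ 2 * m + 2 < 2 * m' := fun hlt => by
    linarith [hmono hlt, h.2.2, h'.2.1]
  obtain rfl | rfl : m' = m ∨ m' = m + 1 := by omega
  · exact Or.inl ⟨rfl, le_antisymm h'.2.2 h.2.1⟩
  · exact Or.inr ⟨rfl, le_antisymm h.2.2 h'.2.1⟩

end Geometry

/-! ### The function computed by the local queries -/

section QueryFunction

variable {M : ℕ} {fhat : List Example → unitInterval → unitInterval} {L η : ℝ} {j : ℕ}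
  {S : Fin M → Example}

theorem queryValue_of_inLong (hL : 0 < L) (hη : 0 < η) (hj : 1 ≤ j) {m : ℕ} {x : unitInterval}
    (h : InLong L η j m x) :
    queryValue fhat L η j S x = (localMin fhat L η j S m x : ℝ) := by
  classical
  have hex : ∃ m, InLong L η j m x := ⟨m, h⟩
  rw [queryValue_eq, dif_pos hex]
  congr 3
  exact (Nat.find_spec hex).unique hL hη hj h

theorem evalAt_coe (f : unitInterval → unitInterval) (x : unitInterval) :
    evalAt f (x : ℝ) = f x := by
  simp [evalAt]

theorem evalAt_nonneg (f : unitInterval → unitInterval) (b : ℝ) : 0 ≤ evalAt f b := (f _).2.1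

theorem evalAt_le_one (f : unitInterval → unitInterval) (b : ℝ) : evalAt f b ≤ 1 := (f _).2.2

/-- A common end point is answered by the long branch of the query. Interpolation takes the same
value there, so the short formula holds on the closed interval and the pieces can be glued. -/
theorem queryValue_of_inShort (hL : 0 < L) (hη : 0 < η) (hj : 1 ≤ j) {m : ℕ} {x : unitInterval}
    (h : InShort L η j m x) :
    queryValue fhat L η j S x = interp fhat L η j S m x := by
  classical
  by_cases hex : ∃ m, InLong L η j m x
  · obtain ⟨m', h'⟩ := hex
    rw [queryValue_of_inLong hL hη hj h']
    rcases h.eq_breakpoint hL hη hj h' with ⟨rfl, hx⟩ | ⟨rfl, hx⟩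
    · simp [interp, ← hx, evalAt_coe]
    · have hb : breakpoint L η j (2 * m + 2) < 1 := h'.1
      have hne : breakpoint L η j (2 * m + 2) - breakpoint L η j (2 * m + 1) ≠ 0 :=
        (sub_pos.2 (breakpoint_strictMono hL hη hj (show 2 * m + 1 < 2 * m + 2 by omega))).ne'
      simp only [interp, if_pos hb, ← evalAt_coe, hx]
      field_simp
      ring
  · have hex' : ∃ m, InShort L η j m x := ⟨m, h⟩
    rw [queryValue_eq, dif_neg hex, dif_pos hex']
    congr 1
    exact (Nat.find_spec hex').unique hL hη hj h

theorem lipClass_iff (hL : 0 < L) {f : unitInterval → unitInterval} :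
    f ∈ lipClass L ↔ ∀ x y, |(f x : ℝ) - f y| ≤ L * |(x : ℝ) - y| := by
  simp only [lipClass, Set.mem_ofPred_eq, lipschitzWith_iff_dist_le_mul, Subtype.dist_eq,
    Real.dist_eq, Real.coe_toNNReal L hL.le]

theorem breakpoint_short_length (L η : ℝ) (j m : ℕ) :
    breakpoint L η j (2 * m + 2) - breakpoint L η j (2 * m + 1) = 1 / L := by
  rw [breakpoint_even_succ, breakpoint_odd]
  ring

/-- The slope is a difference of two values in [0,1] divided by the length 1/L, hence at most L in
absolute value. -/
theorem interp_lipschitz (hL : 0 < L) (m : ℕ) (x y : unitInterval) :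
    |interp fhat L η j S m x - interp fhat L η j S m y| ≤ L * |(x : ℝ) - y| := by
  simp only [interp]
  split_ifs
  · set vl := evalAt (localMin fhat L η j S m) (breakpoint L η j (2 * m + 1))
    set vr := evalAt (localMin fhat L η j S (m + 1)) (breakpoint L η j (2 * m + 2))
    have hv : |vr - vl| ≤ 1 := abs_sub_le_iff.2
      ⟨by linarith [evalAt_le_one (localMin fhat L η j S (m + 1)) (breakpoint L η j (2 * m + 2)),
          evalAt_nonneg (localMin fhat L η j S m) (breakpoint L η j (2 * m + 1))],
        by linarith [evalAt_nonneg (localMin fhat L η j S (m + 1)) (breakpoint L η j (2 * m + 2)),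
          evalAt_le_one (localMin fhat L η j S m) (breakpoint L η j (2 * m + 1))]⟩
    rw [breakpoint_short_length]
    have e : vl + ((x : ℝ) - breakpoint L η j (2 * m + 1)) * ((vr - vl) / (1 / L)) -
        (vl + ((y : ℝ) - breakpoint L η j (2 * m + 1)) * ((vr - vl) / (1 / L))) =
        (vr - vl) * (L * (x - y)) := by
      field_simp
      ring
    rw [e, abs_mul, abs_mul, abs_of_pos hL]
    exact mul_le_of_le_one_left (by positivity) hv
  · rw [sub_self, abs_zero]
    positivity

theorem interp_mem (hL : 0 < L) {m : ℕ} {x : unitInterval} (h : InShort L η j m x) :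
    interp fhat L η j S m x ∈ Set.Icc (0 : ℝ) 1 := by
  simp only [interp]
  split_ifs
  · set bl := breakpoint L η j (2 * m + 1) with hbl
    have hlen : breakpoint L η j (2 * m + 2) = bl + 1 / L := by
      linarith [breakpoint_short_length L η j m]
    have a1 := evalAt_nonneg (localMin fhat L η j S m) bl
    have a2 := evalAt_le_one (localMin fhat L η j S m) bl
    have a3 := evalAt_nonneg (localMin fhat L η j S (m + 1)) (breakpoint L η j (2 * m + 2))
    have a4 := evalAt_le_one (localMin fhat L η j S (m + 1)) (breakpoint L η j (2 * m + 2))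
    set vl := evalAt (localMin fhat L η j S m) bl
    set vr := evalAt (localMin fhat L η j S (m + 1)) (breakpoint L η j (2 * m + 2))
    have hx1 := h.2.1
    have hx2 := h.2.2
    rw [hlen] at hx2
    rw [breakpoint_short_length]
    have e : vl + ((x : ℝ) - bl) * ((vr - vl) / (1 / L)) =
        (1 - L * (x - bl)) * vl + (L * (x - bl)) * vr := by
      field_simp
      ring
    have t0 : 0 ≤ L * (x - bl) := mul_nonneg hL.le (by linarith)
    have t1 : L * (x - bl) ≤ 1 := by
      calc L * (x - bl) ≤ L * (1 / L) := by gcongr; linarith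
        _ = 1 := by field_simp
    rw [e]
    constructor
    · have := mul_nonneg (sub_nonneg.2 t1) a1
      have := mul_nonneg t0 a3
      linarith
    · nlinarith
  · exact ⟨evalAt_nonneg _ _, evalAt_le_one _ _⟩

theorem queryValue_mem (hL : 0 < L) (hη : 0 < η) (hj : 1 ≤ j) (x : unitInterval) :
    queryValue fhat L η j S x ∈ Set.Icc (0 : ℝ) 1 := by
  rcases exists_inLong_or_inShort (j := j) hL hη x with ⟨m, h⟩ | ⟨m, h⟩
  · rw [queryValue_of_inLong hL hη hj h]
    exact (localMin fhat L η j S m x).2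
  · rw [queryValue_of_inShort hL hη hj h]
    exact interp_mem hL h

/-- The function is L-Lipschitz on each closed cell, and adjacent cells share a breakpoint.
Splitting the segment from x to y at the last breakpoint before y gives an induction over cells. -/
theorem queryValue_lipschitz (hL : 0 < L) (hη : 0 < η) (hj : 1 ≤ j)
    (hf : ∀ s, fhat s ∈ lipClass L) (x y : unitInterval) :
    |queryValue fhat L η j S x - queryValue fhat L η j S y| ≤ L * |(x : ℝ) - y| := by
  have hcell : ∀ i (x y : unitInterval), breakpoint L η j i < 1 →
      (x : ℝ) ∈ Set.Icc (breakpoint L η j i) (breakpoint L η j (i + 1)) →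
      (y : ℝ) ∈ Set.Icc (breakpoint L η j i) (breakpoint L η j (i + 1)) →
      |queryValue fhat L η j S x - queryValue fhat L η j S y| ≤ L * |(x : ℝ) - y| := by
    intro i x y hi hx hy
    rcases Nat.even_or_odd' i with ⟨m, rfl | rfl⟩
    · rw [queryValue_of_inLong hL hη hj (m := m) ⟨hi, hx⟩,
        queryValue_of_inLong hL hη hj (m := m) ⟨hi, hy⟩]
      exact (lipClass_iff hL).1 (hf _) x y
    · rw [queryValue_of_inShort hL hη hj (m := m) ⟨hi, hx⟩,
        queryValue_of_inShort hL hη hj (m := m) ⟨hi, hy⟩]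
      exact interp_lipschitz hL m x y
  have key : ∀ n (x y : unitInterval), x ≤ y → (y : ℝ) ≤ breakpoint L η j n →
      |queryValue fhat L η j S x - queryValue fhat L η j S y| ≤ L * |(x : ℝ) - y| := by
    intro n
    induction n with
    | zero =>
      intro x y hxy hy
      have : x = y := le_antisymm hxy (by
        have hy0 : (y : ℝ) ≤ 0 := by simpa [breakpoint] using hy
        exact Subtype.coe_le_coe.1 (hy0.trans x.2.1))
      simp [this]
    | succ n ih =>
      intro x y hxy hy
      by_cases hyn : (y : ℝ) ≤ breakpoint L η j n
      · exact ih x y hxy hyn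
      rw [not_le] at hyn
      have hn : breakpoint L η j n < 1 := hyn.trans_le y.2.2
      by_cases hxn : breakpoint L η j n ≤ x
      · exact hcell n x y hn ⟨hxn, le_trans hxy hy⟩ ⟨hyn.le, hy⟩
      rw [not_le] at hxn
      let z : unitInterval := ⟨breakpoint L η j n, breakpoint_nonneg hL hη hj n, hn.le⟩
      have hz : (z : ℝ) = breakpoint L η j n := rfl
      have h1 := ih x z (Subtype.coe_le_coe.1 hxn.le) le_rfl
      have h2 := hcell n z y hn ⟨le_rfl, (breakpoint_strictMono hL hη hj n.lt_succ_self).le⟩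
        ⟨hyn.le, hy⟩
      rw [hz, abs_of_neg (a := (x : ℝ) - _) (by linarith)] at h1
      rw [hz, abs_of_neg (a := _ - (y : ℝ)) (by linarith)] at h2
      rw [abs_of_neg (a := (x : ℝ) - y) (by linarith)]
      refine (abs_sub_le _ (queryValue fhat L η j S z) _).trans ?_
      linarith
  obtain ⟨i, hi⟩ := exists_le_breakpoint (j := j) hL hη (1 : ℝ)
  rcases le_total x y with h | h
  · exact key _ x y h (y.2.2.trans hi)
  · rw [abs_sub_comm, abs_sub_comm (x : ℝ)]
    exact key _ y x h (x.2.2.trans hi)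

/-- The function computed by the local queries, as a map `[0,1] → [0,1]`. -/
noncomputable def queryFun (fhat : List Example → unitInterval → unitInterval) (L η : ℝ) (j : ℕ)
    (S : Fin M → Example) (x : unitInterval) : unitInterval :=
  Set.projIcc 0 1 zero_le_one (queryValue fhat L η j S x)

theorem coe_queryFun (hL : 0 < L) (hη : 0 < η) (hj : 1 ≤ j) (x : unitInterval) :
    (queryFun fhat L η j S x : ℝ) = queryValue fhat L η j S x := by
  rw [queryFun, Set.projIcc_of_mem zero_le_one (queryValue_mem hL hη hj x)]

theorem queryFun_mem_lipClass (hL : 0 < L) (hη : 0 < η) (hj : 1 ≤ j)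
    (hf : ∀ s, fhat s ∈ lipClass L) : queryFun fhat L η j S ∈ lipClass L := by
  rw [lipClass_iff hL]
  intro x y
  rw [coe_queryFun hL hη hj, coe_queryFun hL hη hj]
  exact queryValue_lipschitz hL hη hj hf x y

/-- For different offsets in `[1, 1 / η]` the sets of points outside the long intervals are
disjoint. -/
theorem offset_unique (hL : 0 < L) (hη : 0 < η) {j' : ℕ} (hj : 1 ≤ j) (hj' : 1 ≤ j')
    (hjη : (j : ℝ) ≤ 1 / η) (hjη' : (j' : ℝ) ≤ 1 / η) {x : unitInterval}
    (h : ¬ ∃ m, InLong L η j m x) (h' : ¬ ∃ m, InLong L η j' m x) : j = j' := by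
  -- With p = 1 + 1/η, the uncovered points satisfy L x ∈ (j + m p, j + m p + 1], and for integers j
  -- in [1, 1/η] these unit intervals are pairwise disjoint. The left end is excluded because it
  -- belongs to a long interval. The right end is not: if it equals 1, no long interval follows.
  have key : ∀ {j : ℕ}, 1 ≤ j → (¬ ∃ m, InLong L η j m x) →
      ∃ m : ℕ, j + m * (1 + 1 / η) < L * x ∧ L * x ≤ j + m * (1 + 1 / η) + 1 := by
    intro j hj h
    have hmono := breakpoint_strictMono hL hη hj
    obtain ⟨m, hm⟩ := (exists_inLong_or_inShort (j := j) hL hη x).resolve_left h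
    have h1 : breakpoint L η j (2 * m + 1) < x := by
      refine lt_of_le_of_ne hm.2.1 fun he => h ⟨m, ?_, ?_, he.ge⟩
      · exact (hmono (Nat.lt_succ_self _)).trans hm.1
      · exact ((hmono (Nat.lt_succ_self _)).trans_le hm.2.1).le
    have h2 : (x : ℝ) ≤ breakpoint L η j (2 * m + 2) := hm.2.2
    have e : j + m * (1 + 1 / η) = L * breakpoint L η j (2 * m + 1) := by
      rw [breakpoint_odd]
      field_simp
    have e' : j + m * (1 + 1 / η) + 1 = L * breakpoint L η j (2 * m + 2) := by
      rw [breakpoint_even_succ]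
      field_simp
    refine ⟨m, ?_, ?_⟩
    · rw [e]
      gcongr
    · rw [e']
      gcongr
  obtain ⟨m, hm1, hm2⟩ := key hj h
  obtain ⟨m', hm1', hm2'⟩ := key hj' h'
  have hp : 0 < 1 + 1 / η := by positivity
  have hlt : ∀ {a b : ℕ}, a < b → (a : ℝ) * (1 + 1 / η) + (1 + 1 / η) ≤ b * (1 + 1 / η) := by
    intro a b hab
    have : (a : ℝ) + 1 ≤ b := by exact_mod_cast hab
    nlinarith
  have hjR : (1 : ℝ) ≤ j := by exact_mod_cast hj
  have hjR' : (1 : ℝ) ≤ j' := by exact_mod_cast hj'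
  obtain hmm | rfl | hmm := lt_trichotomy m m'
  · linarith [hlt hmm]
  · obtain hjj | hjj | hjj := lt_trichotomy j j'
    · have : (j : ℝ) + 1 ≤ j' := by exact_mod_cast hjj
      linarith
    · exact hjj
    · have : (j' : ℝ) + 1 ≤ j := by exact_mod_cast hjj
      linarith
  · linarith [hlt hmm]

end QueryFunction

/-! ### Concentration for the sample points that are kept in a set -/

section Kept

variable {α : Type*} {I : Set α} {φ : α → ENNReal}

open Classical in
/-- The first `K` members of `l` that lie in `I`. -/
noncomputable def kept (I : Set α) (K : ℕ) (l : List α) : List α :=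
  (l.filter fun z => decide (z ∈ I)).take K

theorem kept_nil (I : Set α) (K : ℕ) : kept I K [] = [] := by simp [kept]

theorem kept_zero (I : Set α) (l : List α) : kept I 0 l = [] := by simp [kept]

theorem kept_cons_of_mem {a : α} (h : a ∈ I) (K : ℕ) (l : List α) :
    kept I (K + 1) (a :: l) = a :: kept I K l := by simp [kept, h]

theorem kept_cons_of_notMem {a : α} (h : a ∉ I) (K : ℕ) (l : List α) :
    kept I K (a :: l) = kept I K l := by simp [kept, h]

theorem kept_univ {K : ℕ} {l : List α} (h : l.length ≤ K) : kept Set.univ K l = l := by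
  simp [kept, h]

theorem mem_of_mem_kept {K : ℕ} {l : List α} {a : α} (h : a ∈ kept I K l) : a ∈ I := by
  have := List.mem_of_mem_take h
  simpa using (List.mem_filter.1 this).2

open Classical in
theorem length_kept (K : ℕ) (l : List α) :
    (kept I K l).length = min K (l.countP fun z => decide (z ∈ I)) := by
  simp [kept, List.countP_eq_length_filter]

theorem sum_map_mul_sub (g : α → ℝ) (s c d : ℝ) (l : List α) :
    (l.map fun z => s * (g z - c) - d).sum =
      s * ((l.map g).sum - l.length * c) - l.length * d := by
  induction l with
  | nil => simp
  | cons a l ih =>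
    simp only [List.map_cons, List.sum_cons, ih, List.length_cons]
    push_cast
    ring

/-- This recursion drives the induction on the sample size: the first point either lies in I and
uses up one of the K + 1 places, or it is skipped. -/
theorem prod_kept_cons (K : ℕ) (a : α) (l : List α) :
    ((kept I (K + 1) (a :: l)).map φ).prod =
      I.indicator φ a * ((kept I K l).map φ).prod +
        Iᶜ.indicator 1 a * ((kept I (K + 1) l).map φ).prod := by
  by_cases h : a ∈ I
  · simp [kept_cons_of_mem h, h]
  · simp [kept_cons_of_notMem h, h]

end Kept

section Concentration

variable {α : Type*} [MeasurableSpace α] {D : Measure α} {I : Set α} {φ : α → ENNReal}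

theorem measurable_prod_kept (hI : MeasurableSet I) (hφ : Measurable φ) (M : ℕ) :
    ∀ K, Measurable fun S : Fin M → α => ((kept I K (List.ofFn S)).map φ).prod := by
  induction M with
  | zero => intro K; simp [kept_nil]
  | succ M ih =>
    rintro (_ | K)
    · simp [kept_zero]
    · simp only [List.ofFn_succ, prod_kept_cons]
      have h0 : Measurable fun S : Fin (M + 1) → α => fun i : Fin M => S i.succ := by fun_prop
      exact (((hφ.indicator hI).comp (measurable_pi_apply 0)).mul ((ih K).comp h0)).add
        (((measurable_one.indicator hI.compl).comp (measurable_pi_apply 0)).mul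
          ((ih (K + 1)).comp h0))

/-- If `φ` has mean at most one on `I`, so has the product of `φ` over the first `K` sample points
in `I`. -/
theorem lintegral_prod_kept_le [IsProbabilityMeasure D] (hI : MeasurableSet I)
    (hφ : Measurable φ) (h : ∫⁻ z in I, φ z ∂D ≤ D I) (M : ℕ) :
    ∀ K, ∫⁻ S, ((kept I K (List.ofFn S)).map φ).prod ∂(Measure.pi fun _ : Fin M => D) ≤ 1 := by
  induction M with
  | zero => intro K; simp [kept_nil]
  | succ M ih =>
    rintro (_ | K)
    · simp [kept_zero]
    -- The first point is independent of the others. By the recursion the integral is a mean of φ on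
    -- I times one integral for the shorter sample, plus the mass of the complement times another;
    -- both shorter integrals are at most 1.
    · have hmp := measurePreserving_piFinSuccAbove (fun _ : Fin (M + 1) => D) 0
      set ψ : α × (Fin M → α) → ENNReal := fun p =>
        I.indicator φ p.1 * ((kept I K (List.ofFn p.2)).map φ).prod +
          Iᶜ.indicator 1 p.1 * ((kept I (K + 1) (List.ofFn p.2)).map φ).prod with hψ
      have m1 : Measurable fun p : α × (Fin M → α) =>
          I.indicator φ p.1 * ((kept I K (List.ofFn p.2)).map φ).prod :=
        ((hφ.indicator hI).comp measurable_fst).mul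
          ((measurable_prod_kept hI hφ M K).comp measurable_snd)
      have m2 : Measurable fun p : α × (Fin M → α) =>
          Iᶜ.indicator (1 : α → ENNReal) p.1 *
            ((kept I (K + 1) (List.ofFn p.2)).map φ).prod :=
        ((measurable_one.indicator hI.compl).comp measurable_fst).mul
          ((measurable_prod_kept hI hφ M (K + 1)).comp measurable_snd)
      have e : ∀ S : Fin (M + 1) → α, ((kept I (K + 1) (List.ofFn S)).map φ).prod =
          ψ (MeasurableEquiv.piFinSuccAbove (fun _ => α) 0 S) := by
        intro S
        rw [List.ofFn_succ, prod_kept_cons]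
        rfl
      simp_rw [e]
      rw [hmp.lintegral_comp (f := ψ) (m1.add m2), hψ, lintegral_add_left m1,
        lintegral_prod_mul (hφ.indicator hI).aemeasurable
          (measurable_prod_kept hI hφ M K).aemeasurable,
        lintegral_prod_mul (measurable_one.indicator hI.compl).aemeasurable
          (measurable_prod_kept hI hφ M (K + 1)).aemeasurable,
        lintegral_indicator hI, lintegral_indicator_one hI.compl]
      calc _ ≤ D I * 1 + D Iᶜ * 1 := by
            gcongr
            · exact ih K
            · exact ih (K + 1)
        _ = 1 := by rw [mul_one, mul_one, measure_add_measure_compl hI, measure_univ]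

theorem prod_map_ofReal_exp {β : Type*} (u : β → ℝ) (l : List β) :
    (l.map fun z => ENNReal.ofReal (Real.exp (u z))).prod =
      ENNReal.ofReal (Real.exp (l.map u).sum) := by
  induction l with
  | nil => simp
  | cons a l ih =>
    rw [List.map_cons, List.prod_cons, ih, List.map_cons, List.sum_cons, Real.exp_add,
      ENNReal.ofReal_mul (Real.exp_pos _).le]

/-- Markov's inequality for the exponential of a sum over the kept sample points. -/
theorem measure_kept_exp_le [IsProbabilityMeasure D] (hI : MeasurableSet I) {u : α → ℝ}
    (hu : Measurable u) (h : ∫⁻ z in I, ENNReal.ofReal (Real.exp (u z)) ∂D ≤ D I)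
    (M K : ℕ) (t : ℝ) :
    (Measure.pi fun _ : Fin M => D) {S | t ≤ ((kept I K (List.ofFn S)).map u).sum} ≤
      ENNReal.ofReal (Real.exp (-t)) := by
  have hφ : Measurable fun z => ENNReal.ofReal (Real.exp (u z)) := by fun_prop
  have h1 := mul_meas_ge_le_lintegral (μ := Measure.pi fun _ : Fin M => D)
    (measurable_prod_kept hI hφ M K) (ENNReal.ofReal (Real.exp t))
  have h2 := h1.trans (lintegral_prod_kept_le hI hφ h M K)
  simp_rw [prod_map_ofReal_exp] at h2
  rw [Real.exp_neg, ENNReal.ofReal_inv_of_pos (Real.exp_pos t), ← one_div,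
    ENNReal.le_div_iff_mul_le (Or.inl (by simp [Real.exp_pos])) (Or.inl ENNReal.ofReal_ne_top),
    mul_comm]
  refine le_trans ?_ h2
  gcongr with S
  intro hS
  exact ENNReal.ofReal_le_ofReal (Real.exp_le_exp.2 hS)

/-- Hoeffding's lemma on a set. -/
theorem setLIntegral_exp_le [IsProbabilityMeasure D] {g : α → ℝ}
    (hg : Measurable g) (hg01 : ∀ z, g z ∈ Set.Icc (0 : ℝ) 1) (s : ℝ) :
    ∫⁻ z in I, ENNReal.ofReal
      (Real.exp (s * (g z - ∫ z, g z ∂(ProbabilityTheory.cond D I)) - s ^ 2 / 8)) ∂D ≤ D I := by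
  by_cases h0 : D I = 0
  · rw [Measure.restrict_eq_zero.2 h0, lintegral_zero_measure]
    exact zero_le
  have := ProbabilityTheory.cond_isProbabilityMeasure h0
  set μ := ProbabilityTheory.cond D I with hμ
  have hsub := ProbabilityTheory.hasSubgaussianMGF_of_mem_Icc (μ := μ) hg.aemeasurable
    (Filter.Eventually.of_forall hg01)
  have hle := hsub.mgf_le s
  have hint := hsub.integrable_exp_mul s
  have h1 : ∫⁻ z, ENNReal.ofReal (Real.exp (s * (g z - ∫ z, g z ∂μ) - s ^ 2 / 8)) ∂μ ≤ 1 := by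
    rw [← ofReal_integral_eq_lintegral_ofReal _
      (Filter.Eventually.of_forall fun z => (Real.exp_pos _).le)]
    · rw [ENNReal.ofReal_le_one]
      simp_rw [Real.exp_sub]
      rw [integral_div, div_le_one (Real.exp_pos _)]
      refine hle.trans (Real.exp_le_exp.2 (le_of_eq ?_))
      simp
      ring
    · simp_rw [Real.exp_sub]
      exact hint.div_const _
  generalize ∫ z, g z ∂μ = e at h1 ⊢
  rw [hμ, ProbabilityTheory.cond, lintegral_smul_measure, smul_eq_mul, mul_comm,
    ← div_eq_mul_inv] at h1
  rwa [ENNReal.div_le_iff h0 (measure_ne_top _ _), one_mul] at h1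

/-- One-sided deviation bound for the kept sample points. -/
theorem measure_deviation_le [IsProbabilityMeasure D] (hI : MeasurableSet I) {g : α → ℝ}
    (hg : Measurable g) (hg01 : ∀ z, g z ∈ Set.Icc (0 : ℝ) 1) {τ : ℝ} (hτ : 0 ≤ τ) (n₀ : ℝ)
    (M K : ℕ) :
    (Measure.pi fun _ : Fin M => D) {S | n₀ ≤ (kept I K (List.ofFn S)).length ∧
        τ * (kept I K (List.ofFn S)).length ≤ ((kept I K (List.ofFn S)).map g).sum -
          (kept I K (List.ofFn S)).length * ∫ z, g z ∂(ProbabilityTheory.cond D I)} ≤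
      ENNReal.ofReal (Real.exp (-(2 * τ ^ 2 * n₀))) := by
  -- The choice s = 4τ is optimal: with n kept points the exponent is at least 4τ²n - (s²/8)n = 2τ²n
  -- ≥ 2τ²n₀.
  refine le_trans (measure_mono ?_)
    (measure_kept_exp_le hI (by fun_prop) (setLIntegral_exp_le hg hg01 (4 * τ)) M K _)
  rintro S ⟨h1, h2⟩
  simp only [Set.mem_ofPred_eq, sum_map_mul_sub]
  nlinarith [mul_le_mul_of_nonneg_left h2 hτ, mul_le_mul_of_nonneg_left h1 (sq_nonneg τ)]

/-- Two-sided deviation bound for the kept sample points. -/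
theorem measure_abs_deviation_le [IsProbabilityMeasure D] (hI : MeasurableSet I) {g : α → ℝ}
    (hg : Measurable g) (hg01 : ∀ z, g z ∈ Set.Icc (0 : ℝ) 1) {τ : ℝ} (hτ : 0 ≤ τ) (n₀ : ℝ)
    (M K : ℕ) :
    (Measure.pi fun _ : Fin M => D) {S | n₀ ≤ (kept I K (List.ofFn S)).length ∧
        τ * (kept I K (List.ofFn S)).length ≤ |((kept I K (List.ofFn S)).map g).sum -
          (kept I K (List.ofFn S)).length * ∫ z, g z ∂(ProbabilityTheory.cond D I)|} ≤
      2 * ENNReal.ofReal (Real.exp (-(2 * τ ^ 2 * n₀))) := by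
  -- On a null set `cond` is the zero measure, so the mean of 1 - g is not 1 minus the mean of g.
  -- The deviation is then nonnegative and the upper tail suffices.
  by_cases h0 : D I = 0
  · have hlt := measure_deviation_le hI hg hg01 hτ n₀ M K (D := D)
    have hz : ProbabilityTheory.cond D I = 0 := by
      rw [ProbabilityTheory.cond, Measure.restrict_eq_zero.2 h0, smul_zero]
    rw [two_mul]
    refine le_trans (measure_mono fun S hS => ?_) (hlt.trans le_self_add)
    refine ⟨hS.1, ?_⟩
    have h2 := hS.2
    rwa [abs_of_nonneg] at h2
    rw [hz, integral_zero_measure, mul_zero, sub_zero]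
    refine List.sum_nonneg fun v hv => ?_
    obtain ⟨a, -, rfl⟩ := List.mem_map.1 hv
    exact (hg01 a).1
  have := ProbabilityTheory.cond_isProbabilityMeasure h0
  have hint : Integrable g (ProbabilityTheory.cond D I) :=
    Integrable.of_mem_Icc 0 1 hg.aemeasurable (Filter.Eventually.of_forall hg01)
  have h1 := measure_deviation_le hI hg hg01 hτ n₀ M K (D := D)
  have h2 := measure_deviation_le hI (g := fun z => 1 - g z) (measurable_const.sub hg)
    (fun z => ⟨by linarith [(hg01 z).2], by linarith [(hg01 z).1]⟩) hτ n₀ M K (D := D)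
  rw [two_mul]
  refine le_trans (measure_mono ?_) ((measure_union_le _ _).trans (add_le_add h1 h2))
  rintro S ⟨hn, hS⟩
  rcases le_abs.1 hS with h | h
  · exact Or.inl ⟨hn, h⟩
  · refine Or.inr ⟨hn, ?_⟩
    have e : (∫ z, (1 - g z) ∂(ProbabilityTheory.cond D I)) =
        1 - ∫ z, g z ∂(ProbabilityTheory.cond D I) := by
      rw [integral_sub (integrable_const _) hint]
      simp
    have e2 := sum_map_mul_sub g (-1) 1 0 (kept I K (List.ofFn S))
    have e3 : (fun z => -1 * (g z - 1) - 0) = fun z => 1 - g z := by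
      ext z
      ring
    rw [e3] at e2
    rw [e, e2]
    linarith

/-- A set of large mass receives many sample points. -/
theorem measure_length_kept_lt_le [IsProbabilityMeasure D] (hI : MeasurableSet I) {n₀ : ℝ}
    {M K : ℕ} (hK : n₀ ≤ K) (hM : 4 * n₀ ≤ M * D.real I) :
    (Measure.pi fun _ : Fin M => D) {S | ((kept I K (List.ofFn S)).length : ℝ) < n₀} ≤
      ENNReal.ofReal (Real.exp (-n₀)) := by
  classical
  set p := D.real I with hp
  set ind : α → ℝ := I.indicator 1 with hind
  have hmeas : Measurable ind := measurable_one.indicator hI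
  -- Chernoff's bound for the count: since exp(-1) ≤ 1/2, the mean of exp(-ind) is at most 1 - p/2 ≤
  -- exp(-p/2).
  have hu : ∫⁻ z in Set.univ, ENNReal.ofReal (Real.exp (-1 * (ind z - 0) - -(p / 2))) ∂D ≤
      D Set.univ := by
    rw [Measure.restrict_univ, measure_univ]
    have hpt : ∀ z, Real.exp (-1 * (ind z - 0) - -(p / 2)) ≤
        Real.exp (p / 2) * (1 - ind z / 2) := by
      intro z
      rw [sub_neg_eq_add, add_comm, Real.exp_add]
      gcongr
      by_cases hz : z ∈ I
      · simp only [hind, Set.indicator_of_mem hz, Pi.one_apply]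
        have : Real.exp (-1) ≤ 1 / 2 := by
          rw [Real.exp_neg, inv_le_comm₀ (Real.exp_pos _) (by norm_num)]
          have := Real.add_one_le_exp 1
          norm_num at this ⊢
          exact this
        norm_num at this ⊢
        exact this
      · simp [hind, hz]
    have hint : Integrable ind D := (integrable_const 1).indicator hI
    have hI' : ∫ z, ind z ∂D = p := by
      rw [hind, integral_indicator_one hI]
    calc _ ≤ ∫⁻ z, ENNReal.ofReal (Real.exp (p / 2) * (1 - ind z / 2)) ∂D :=
          lintegral_mono fun z => ENNReal.ofReal_le_ofReal (hpt z)
      _ = ENNReal.ofReal (∫ z, Real.exp (p / 2) * (1 - ind z / 2) ∂D) := by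
          rw [ofReal_integral_eq_lintegral_ofReal]
          · exact ((integrable_const _).sub (hint.div_const _)).const_mul _
          · exact Filter.Eventually.of_forall fun z => (Real.exp_pos _).le.trans (hpt z)
      _ ≤ 1 := by
          rw [ENNReal.ofReal_le_one, integral_const_mul,
            integral_sub (integrable_const _) (hint.div_const _), integral_div, hI']
          have h1 : 1 - p / 2 ≤ Real.exp (-(p / 2)) := by
            linarith [Real.add_one_le_exp (-(p / 2))]
          calc _ ≤ Real.exp (p / 2) * Real.exp (-(p / 2)) := by
                gcongr
                simpa using h1
            _ = 1 := by rw [← Real.exp_add]; simp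
  -- With `Set.univ` and K = M nothing is dropped, so the exponent is M p/2 minus the number of
  -- points in I. This exceeds 2n₀ - n₀ when fewer than n₀ points fall into I; the cap cannot be the
  -- cause of a shortage, as n₀ ≤ K.
  refine le_trans (measure_mono ?_) (measure_kept_exp_le MeasurableSet.univ (by fun_prop) hu M M n₀)
  intro S hS
  simp only [Set.mem_ofPred_eq] at hS ⊢
  rw [kept_univ (by simp), sum_map_mul_sub]
  have hcount : ((List.ofFn S).map ind).sum =
      ((List.ofFn S).countP fun z => decide (z ∈ I) : ℕ) := by
    generalize List.ofFn S = l
    induction l with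
    | nil => simp
    | cons a l ih =>
      rw [List.map_cons, List.sum_cons, ih, List.countP_cons]
      by_cases ha : a ∈ I <;> simp [hind, ha, add_comm]
  rw [hcount]
  rw [length_kept, Nat.cast_min, min_lt_iff] at hS
  have hS' := hS.resolve_left (not_lt.2 hK)
  simp only [List.length_ofFn]
  linarith

end Concentration

/-! ### Uniform convergence on one interval -/

section Uniform

variable {D : Measure Example} {I : Set Example} {L τ lam l : ℝ}

/-- The absolute loss of `f` on an example. -/
noncomputable def loss (f : unitInterval → unitInterval) (z : Example) : ℝ :=
  |(z.2 : ℝ) - (f z.1 : ℝ)|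

theorem abs_sub_mem_Icc {a b : ℝ} (ha : a ∈ Set.Icc (0 : ℝ) 1) (hb : b ∈ Set.Icc (0 : ℝ) 1) :
    |a - b| ∈ Set.Icc (0 : ℝ) 1 :=
  ⟨abs_nonneg _, abs_sub_le_iff.2 ⟨by linarith [ha.2, hb.1], by linarith [ha.1, hb.2]⟩⟩

theorem loss_mem (f : unitInterval → unitInterval) (z : Example) :
    loss f z ∈ Set.Icc (0 : ℝ) 1 :=
  abs_sub_mem_Icc z.2.2 (f z.1).2

theorem measurable_of_mem_lipClass {f : unitInterval → unitInterval} (hf : f ∈ lipClass L) :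
    Measurable f :=
  (LipschitzWith.continuous hf).measurable

theorem measurable_loss {f : unitInterval → unitInterval} (hf : f ∈ lipClass L) :
    Measurable (loss f) := by
  have := measurable_of_mem_lipClass hf
  unfold loss
  simp_rw [← Real.norm_eq_abs]
  fun_prop

theorem integrable_loss [IsFiniteMeasure D] {f : unitInterval → unitInterval}
    (hf : f ∈ lipClass L) : Integrable (loss f) D :=
  Integrable.of_mem_Icc 0 1 (measurable_loss hf).aemeasurable
    (Filter.Eventually.of_forall (loss_mem f))

/-- A finite family of losses of step functions that approximates the losses of all members of the
class on a strip of width `lam / L`. -/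
theorem exists_cover (hL : 0 < L) (hτ : 0 < τ)
    (hI : ∀ z ∈ I, l ≤ (z.1 : ℝ) ∧ L * (z.1 - l) ≤ lam) :
    ∃ Φ : (Fin (⌊lam / τ⌋₊ + 1) → Fin (⌊1 / τ⌋₊ + 1)) → Example → ℝ,
      (∀ g, Measurable (Φ g)) ∧ (∀ g z, Φ g z ∈ Set.Icc (0 : ℝ) 1) ∧
      ∀ f ∈ lipClass L, ∃ g, ∀ z ∈ I, |loss f z - Φ g z| ≤ 2 * τ := by
  -- Step functions with cells of width τ/L and values in τℕ. One τ of the final error pays for the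
  -- variation of f inside a cell, the other for rounding its value. Indices beyond the last cell
  -- get the value 0 and do not occur on I.
  let G : (Fin (⌊lam / τ⌋₊ + 1) → Fin (⌊1 / τ⌋₊ + 1)) → ℕ → ℝ := fun g k =>
    if h : k < ⌊lam / τ⌋₊ + 1 then τ * ((g ⟨k, h⟩ : ℕ) : ℝ) else 0
  have hG : ∀ g k, G g k ∈ Set.Icc (0 : ℝ) 1 := by
    intro g k
    simp only [G]
    split_ifs with h
    · refine ⟨by positivity, ?_⟩
      have h1 : ((g ⟨k, h⟩ : ℕ) : ℝ) ≤ 1 / τ :=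
        (Nat.cast_le.2 (Nat.lt_succ_iff.1 (g ⟨k, h⟩).2)).trans (Nat.floor_le (by positivity))
      calc τ * ((g ⟨k, h⟩ : ℕ) : ℝ) ≤ τ * (1 / τ) := by gcongr
        _ = 1 := by field_simp
    · simp
  refine ⟨fun g z => |(z.2 : ℝ) - G g ⌊L * ((z.1 : ℝ) - l) / τ⌋₊|, ?_, ?_, ?_⟩
  · intro g
    have h1 : Measurable fun z : Example => ⌊L * ((z.1 : ℝ) - l) / τ⌋₊ :=
      Nat.measurable_floor.comp (by fun_prop)
    have h2 : Measurable fun z : Example => G g ⌊L * ((z.1 : ℝ) - l) / τ⌋₊ :=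
      (measurable_of_countable (G g)).comp h1
    simp_rw [← Real.norm_eq_abs]
    fun_prop
  · exact fun g z => abs_sub_mem_Icc z.2.2 (hG _ _)
  · intro f hf
    -- Grid points may leave [0,1]. Projecting them back is nonexpansive, so it does not increase
    -- their distance to z.
    let pt : ℕ → unitInterval := fun k => Set.projIcc 0 1 zero_le_one (l + k * τ / L)
    refine ⟨fun k => ⟨⌊(f (pt k) : ℝ) / τ⌋₊, Nat.lt_succ_iff.2 (Nat.floor_mono ?_)⟩, ?_⟩
    · have := (f (pt k)).2.2
      gcongr
    · intro z hz
      obtain ⟨h1, h2⟩ := hI z hz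
      set k := ⌊L * ((z.1 : ℝ) - l) / τ⌋₊ with hk
      have hkn : k < ⌊lam / τ⌋₊ + 1 := Nat.lt_succ_iff.2 (Nat.floor_mono (by gcongr))
      have h0 : 0 ≤ L * ((z.1 : ℝ) - l) / τ :=
        div_nonneg (mul_nonneg hL.le (sub_nonneg.2 h1)) hτ.le
      have hk1 : (k : ℝ) ≤ L * ((z.1 : ℝ) - l) / τ := Nat.floor_le h0
      have hk2 : L * ((z.1 : ℝ) - l) / τ < k + 1 := Nat.lt_floor_add_one _
      rw [le_div_iff₀ hτ] at hk1
      rw [div_lt_iff₀ hτ] at hk2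
      have hpt : L * |(z.1 : ℝ) - pt k| ≤ τ := by
        have hp : |(z.1 : ℝ) - pt k| ≤ |(z.1 : ℝ) - (l + k * τ / L)| := by
          have := (LipschitzWith.projIcc (zero_le_one (α := ℝ))).dist_le_mul
            (z.1 : ℝ) (l + k * τ / L)
          rw [Set.projIcc_val] at this
          simpa [Subtype.dist_eq, Real.dist_eq] using this
        refine (mul_le_mul_of_nonneg_left hp hL.le).trans ?_
        rw [← abs_of_pos hL, ← abs_mul, abs_of_pos hL,
          show L * ((z.1 : ℝ) - (l + k * τ / L)) = L * (z.1 - l) - k * τ by field_simp; ring,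
          abs_of_nonneg (by linarith)]
        linarith
      have hf1 := ((lipClass_iff hL).1 hf z.1 (pt k)).trans hpt
      have hf2 : |(f (pt k) : ℝ) - τ * ⌊(f (pt k) : ℝ) / τ⌋₊| ≤ τ := by
        have a0 : 0 ≤ (f (pt k) : ℝ) / τ := div_nonneg (f (pt k)).2.1 hτ.le
        have a1 := Nat.floor_le a0
        have a2 := Nat.lt_floor_add_one ((f (pt k) : ℝ) / τ)
        rw [le_div_iff₀ hτ] at a1
        rw [div_lt_iff₀ hτ] at a2
        rw [abs_of_nonneg (by linarith)]
        linarith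
      simp only [G, loss, ← hk, dif_pos hkn]
      refine (abs_abs_sub_abs_le_abs_sub _ _).trans ?_
      rw [sub_sub_sub_cancel_left, abs_sub_comm]
      refine (abs_sub_le _ (f (pt k) : ℝ) _).trans ?_
      linarith

theorem abs_sum_map_sub_le {α : Type*} {u v : α → ℝ} {c : ℝ} {s : List α}
    (h : ∀ z ∈ s, |u z - v z| ≤ c) : |(s.map u).sum - (s.map v).sum| ≤ c * s.length := by
  induction s with
  | nil => simp
  | cons a s ih =>
    have h1 := h a (by simp)
    have h2 := ih fun z hz => h z (by simp [hz])
    simp only [List.map_cons, List.sum_cons, List.length_cons]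
    push_cast
    rw [add_sub_add_comm]
    refine (abs_add_le _ _).trans ?_
    linarith

/-- Uniform convergence of the empirical losses on a strip of width `lam / L`. -/
theorem measure_exists_deviation_le [IsProbabilityMeasure D] (hL : 0 < L) (hτ : 0 < τ)
    (hmeas : MeasurableSet I) (hI : ∀ z ∈ I, l ≤ (z.1 : ℝ) ∧ L * (z.1 - l) ≤ lam) (n₀ : ℝ)
    (M K : ℕ) :
    (Measure.pi fun _ : Fin M => D) {S | n₀ ≤ (kept I K (List.ofFn S)).length ∧
        ∃ f ∈ lipClass L, 5 * τ * (kept I K (List.ofFn S)).length <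
          |((kept I K (List.ofFn S)).map (loss f)).sum -
          (kept I K (List.ofFn S)).length * ∫ z, loss f z ∂(ProbabilityTheory.cond D I)|} ≤
      ((⌊1 / τ⌋₊ + 1) ^ (⌊lam / τ⌋₊ + 1) : ℕ) *
        (2 * ENNReal.ofReal (Real.exp (-(2 * τ ^ 2 * n₀)))) := by
  obtain ⟨Φ, hΦm, hΦ01, hΦ⟩ := exists_cover hL hτ hI
  have hdev := fun g => measure_abs_deviation_le (D := D) hmeas (hΦm g) (hΦ01 g) hτ.le n₀ M K
  refine le_trans (measure_mono ?_) ((measure_iUnion_fintype_le _ _).trans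
    ((Finset.sum_le_sum fun g _ => hdev g).trans (le_of_eq ?_)))
  · rintro S ⟨hn, f, hf, hlt⟩
    -- Replacing f by a cover element costs 2τ in the empirical mean and 2τ in the true mean; of a
    -- deviation of 5τ at least τ is left.
    obtain ⟨g, hg⟩ := hΦ f hf
    refine Set.mem_iUnion.2 ⟨g, hn, ?_⟩
    have h1 := abs_sum_map_sub_le (u := loss f) (v := Φ g) (s := kept I K (List.ofFn S))
      fun z hz => hg z (mem_of_mem_kept hz)
    have h2 : |(∫ z, loss f z ∂(ProbabilityTheory.cond D I)) -
        ∫ z, Φ g z ∂(ProbabilityTheory.cond D I)| ≤ 2 * τ := by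
      by_cases h0 : D I = 0
      · have hz : ProbabilityTheory.cond D I = 0 := by
          rw [ProbabilityTheory.cond, Measure.restrict_eq_zero.2 h0, smul_zero]
        simp [hz, hτ.le]
      · have := ProbabilityTheory.cond_isProbabilityMeasure h0
        rw [← integral_sub (integrable_loss hf) (Integrable.of_mem_Icc 0 1 (hΦm g).aemeasurable
          (Filter.Eventually.of_forall (hΦ01 g)))]
        have h3 := norm_integral_le_of_norm_le_const (μ := ProbabilityTheory.cond D I)
          (f := fun z => loss f z - Φ g z) (C := 2 * τ)
          (by filter_upwards [ProbabilityTheory.ae_cond_mem hmeas] with z hz using hg z hz)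
        simpa using h3
    generalize (∫ z, loss f z ∂(ProbabilityTheory.cond D I)) = e1 at *
    generalize (∫ z, Φ g z ∂(ProbabilityTheory.cond D I)) = e2 at *
    generalize hn' : ((kept I K (List.ofFn S)).length : ℝ) = n at *
    have hn0 : 0 ≤ n := hn' ▸ Nat.cast_nonneg _
    have h4 : |n * e1 - n * e2| ≤ 2 * τ * n := by
      rw [← mul_sub, abs_mul, abs_of_nonneg hn0, mul_comm]
      gcongr
    rw [abs_le] at h1 h4
    rcases lt_abs.1 hlt with h | h
    · exact le_abs.2 (Or.inl (by linarith [h1.2, h4.1]))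
    · exact le_abs.2 (Or.inr (by linarith [h1.1, h4.2]))
  · rw [Finset.sum_const, Finset.card_univ, Fintype.card_fun, Fintype.card_fin, Fintype.card_fin,
      nsmul_eq_mul]

/-- If all empirical losses are close to their means, then an empirical risk minimiser has small
excess error. -/
theorem excess_le_of_deviation [IsFiniteMeasure D] {s : List Example}
    {fhat f : unitInterval → unitInterval} (hfhat : fhat ∈ lipClass L) (hf : f ∈ lipClass L)
    (hs : s ≠ []) (hmin : empErr s fhat ≤ empErr s f)
    (hdev : ∀ f ∈ lipClass L, |(s.map (loss f)).sum -
      s.length * ∫ z, loss f z ∂(ProbabilityTheory.cond D I)| ≤ 5 * τ * s.length) :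
    ∫ z in I, (loss fhat z - loss f z) ∂D ≤ 10 * τ * D.real I := by
  have hint : ∀ g : Example → ℝ, ∫ z in I, g z ∂D =
      D.real I * ∫ z, g z ∂(ProbabilityTheory.cond D I) := by
    intro g
    by_cases h0 : D I = 0
    · rw [Measure.restrict_eq_zero.2 h0, integral_zero_measure, Measure.real, h0]
      simp
    · have : D.real I ≠ 0 := by
        simpa [Measure.real, ENNReal.toReal_eq_zero_iff] using h0
      rw [ProbabilityTheory.cond, integral_smul_measure, ENNReal.toReal_inv, ← Measure.real,
        smul_eq_mul, mul_inv_cancel_left₀ this]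
  have hn : (0 : ℝ) < s.length := by exact_mod_cast List.length_pos_iff.2 hs
  have h1 := abs_le.1 (hdev fhat hfhat)
  have h2 := abs_le.1 (hdev f hf)
  have h3 : (s.map (loss fhat)).sum ≤ (s.map (loss f)).sum := hmin
  rw [integral_sub (integrable_loss hfhat) (integrable_loss hf), hint, hint, ← mul_sub, mul_comm]
  refine mul_le_mul_of_nonneg_right ?_ measureReal_nonneg
  refine le_of_mul_le_mul_left ?_ hn
  linarith [h1.1, h2.2]

end Uniform

/-! ### The long intervals -/

section LongIntervals

/-- The number of sample points that suffices on a strip of width `lam / L`. -/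
noncomputable def sampleBound (lam η : ℝ) : ℝ :=
  (lam / (2 * η) + 3) * Real.log (1 / η) / (8 * η ^ 2)

variable {lam η : ℝ}

theorem log_inv_pos (hη : 0 < η) (hη2 : η ≤ 1 / 2) : 0 < Real.log (1 / η) :=
  Real.log_pos (by rw [lt_div_iff₀ hη]; linarith)

theorem log_le_sampleBound (hlam : 0 ≤ lam) (hη : 0 < η) (hη2 : η ≤ 1 / 2) :
    Real.log (1 / η) ≤ sampleBound lam η := by
  have hlog := log_inv_pos hη hη2
  rw [sampleBound, le_div_iff₀ (by positivity), mul_comm]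
  refine mul_le_mul_of_nonneg_right ?_ hlog.le
  have : 0 ≤ lam / (2 * η) := by positivity
  nlinarith

/-- Discarding pool points is therefore harmless: an interval that reaches the cap already has
enough of them. -/
theorem sampleBound_le_cap (hη : 0 < η) (hη2 : η ≤ 1 / 2)
    (hlam : lam ≤ 1 / η) : sampleBound lam η ≤ cap η := by
  have hlog := log_inv_pos hη hη2
  have h1 : sampleBound lam η ≤ 1 / (2 * η ^ 4) * Real.log (1 / η) := by
    rw [sampleBound, mul_div_right_comm]
    refine mul_le_mul_of_nonneg_right ?_ hlog.le
    have h2 : lam / (2 * η) ≤ 1 / (2 * η ^ 2) := by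
      calc lam / (2 * η) ≤ 1 / η / (2 * η) := by gcongr
        _ = 1 / (2 * η ^ 2) := by field_simp
    calc (lam / (2 * η) + 3) / (8 * η ^ 2) ≤ (1 / (2 * η ^ 2) + 3) / (8 * η ^ 2) := by gcongr
      _ = (1 + 6 * η ^ 2) / (16 * η ^ 4) := by field_simp; ring
      _ ≤ 8 / (16 * η ^ 4) := by gcongr; nlinarith
      _ = 1 / (2 * η ^ 4) := by field_simp; norm_num
  refine h1.trans ?_
  rw [cap]
  push_cast
  exact (Nat.lt_floor_add_one _).le

theorem exp_neg_sampleBound_le (hlam : 0 ≤ lam) (hη : 0 < η) (hη2 : η ≤ 1 / 2) :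
    Real.exp (-sampleBound lam η) ≤ η := by
  calc Real.exp (-sampleBound lam η) ≤ Real.exp (-Real.log (1 / η)) := by
        gcongr
        exact log_le_sampleBound hlam hη hη2
    _ = η := by rw [one_div, Real.log_inv, neg_neg, Real.exp_log hη]

/-- The exponential is η to the power lam/(2η) + 3. The cover has at most (1/η)^(lam/(2η) + 1)
elements and the factor 2 is at most 1/η, so of the summand 3 one unit is left, which gives η. -/
theorem cover_mul_exp_le (hlam : 0 ≤ lam) (hη : 0 < η) (hη2 : η ≤ 1 / 2) :
    ((⌊1 / (2 * η)⌋₊ + 1) ^ (⌊lam / (2 * η)⌋₊ + 1) : ℕ) *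
      (2 * Real.exp (-(2 * (2 * η) ^ 2 * sampleBound lam η))) ≤ η := by
  have hlog := log_inv_pos hη hη2
  have hinv : 2 ≤ 1 / η := by rw [le_div_iff₀ hη]; linarith
  have hb : (⌊1 / (2 * η)⌋₊ : ℝ) + 1 ≤ 1 / η := by
    have h1 : (⌊1 / (2 * η)⌋₊ : ℝ) ≤ 1 / (2 * η) := Nat.floor_le (by positivity)
    have h2 : 1 / (2 * η) = 1 / η / 2 := by field_simp
    linarith
  have ha : (⌊lam / (2 * η)⌋₊ : ℝ) ≤ lam / (2 * η) := Nat.floor_le (by positivity)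
  have hs : 2 * (2 * η) ^ 2 * sampleBound lam η = (lam / (2 * η) + 3) * Real.log (1 / η) := by
    rw [sampleBound]
    field_simp
    ring
  have hexp : Real.exp (Real.log (1 / η)) = 1 / η := Real.exp_log (by positivity)
  rw [hs]
  push_cast
  calc ((⌊1 / (2 * η)⌋₊ : ℝ) + 1) ^ (⌊lam / (2 * η)⌋₊ + 1) *
        (2 * Real.exp (-((lam / (2 * η) + 3) * Real.log (1 / η))))
      ≤ (1 / η) ^ (⌊lam / (2 * η)⌋₊ + 1) *
        (1 / η * Real.exp (-((lam / (2 * η) + 3) * Real.log (1 / η)))) := by gcongr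
    _ = Real.exp (((⌊lam / (2 * η)⌋₊ : ℝ) - lam / (2 * η) - 1) * Real.log (1 / η)) := by
        rw [← mul_assoc, ← pow_succ, ← hexp, ← Real.exp_nat_mul, ← Real.exp_add, hexp]
        congr 1
        push_cast
        ring
    _ ≤ Real.exp (-Real.log (1 / η)) := by
        gcongr
        nlinarith
    _ = η := by rw [one_div, Real.log_inv, neg_neg, Real.exp_log hη]

variable {M : ℕ} {fhat : List Example → unitInterval → unitInterval} {L : ℝ} {j : ℕ}
  {D : Measure Example}

/-- The examples that lie over the `m`-th long interval. -/
def longSet (L η : ℝ) (j m : ℕ) : Set Example := {z | InLong L η j m z.1}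

theorem measurableSet_inLong (L η : ℝ) (j m : ℕ) : MeasurableSet {x | InLong L η j m x} := by
  unfold InLong
  measurability

theorem measurableSet_inShort (L η : ℝ) (j m : ℕ) : MeasurableSet {x | InShort L η j m x} := by
  unfold InShort
  measurability

theorem measurableSet_longSet (L η : ℝ) (j m : ℕ) : MeasurableSet (longSet L η j m) :=
  measurable_fst (measurableSet_inLong L η j m)

/-- Membership in a long interval depends on the point only, so the capped pool falls under the
concentration bounds for `kept`. -/
theorem poolExamples_eq_kept (S : Fin M → Example) (m : ℕ) :
    poolExamples L η j S m = kept (longSet L η j m) (cap η) (List.ofFn S) := by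
  simp only [poolExamples, poolIn, kept, cap, List.ofFn_eq_map, List.filter_map, List.map_take]
  rfl

/-- The pools for which the minimiser on the `m`-th long interval has a large excess error. -/
def badPools (fhat : List Example → unitInterval → unitInterval) (L η : ℝ) (j : ℕ)
    (D : Measure Example) (M m : ℕ) : Set (Fin M → Example) :=
  {S | ∃ f ∈ lipClass L, 20 * η * D.real (longSet L η j m) <
    ∫ z in longSet L η j m, (loss (localMin fhat L η j S m) z - loss f z) ∂D}

/-- Learning fails only if the interval receives too few points or some empirical loss deviates by
more than 5τ, with τ = 2η. Each event has probability at most η. -/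
theorem measure_badPools_le [IsProbabilityMeasure D] (hL : 0 < L) (hη : 0 < η)
    (hη2 : η ≤ 1 / 2) (hj : 1 ≤ j) (hjη : (j : ℝ) ≤ 1 / η) (hf : IsERMRule L fhat) {m : ℕ}
    (hM : 4 * sampleBound (min L (1 / η)) η ≤ M * D.real (longSet L η j m)) :
    (Measure.pi fun _ : Fin M => D) (badPools fhat L η j D M m) ≤ ENNReal.ofReal (2 * η) := by
  -- L times the width of the interval: the width is at most 1 and at most 1/(Lη). The minimum keeps
  -- the pool small when L is small.
  set lam := min L (1 / η) with hlam
  have hlam0 : 0 ≤ lam := le_min hL.le (by positivity)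
  have hI : ∀ z ∈ longSet L η j m, breakpoint L η j (2 * m) ≤ (z.1 : ℝ) ∧
      L * (z.1 - breakpoint L η j (2 * m)) ≤ lam := by
    intro z hz
    refine ⟨hz.2.1, le_min ?_ ?_⟩
    · have h1 := z.1.2.2
      have h2 := breakpoint_nonneg hL hη hj (2 * m)
      exact mul_le_of_le_one_right hL.le (by linarith)
    · have h1 := breakpoint_long_length hL hjη m
      have h2 := hz.2.2
      calc L * (z.1 - breakpoint L η j (2 * m)) ≤ L * (1 / (L * η)) := by gcongr; linarith
        _ = 1 / η := by field_simp
  have hmeas := measurableSet_longSet L η j m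
  have h1 := measure_length_kept_lt_le (D := D) (n₀ := sampleBound lam η) hmeas
    (sampleBound_le_cap hη hη2 (min_le_right _ _)) hM
  have h2 := measure_exists_deviation_le (D := D) hL (τ := 2 * η) (by positivity) hmeas hI
    (sampleBound lam η) M (cap η)
  have hbound : ((⌊1 / (2 * η)⌋₊ + 1) ^ (⌊lam / (2 * η)⌋₊ + 1) : ℕ) *
        (2 * ENNReal.ofReal (Real.exp (-(2 * (2 * η) ^ 2 * sampleBound lam η)))) ≤
      ENNReal.ofReal η := by
    refine le_trans (le_of_eq ?_) (ENNReal.ofReal_le_ofReal (cover_mul_exp_le hlam0 hη hη2))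
    rw [ENNReal.ofReal_mul (Nat.cast_nonneg _), ENNReal.ofReal_natCast,
      ENNReal.ofReal_mul (by norm_num), ENNReal.ofReal_ofNat]
  rw [two_mul, ENNReal.ofReal_add hη.le hη.le]
  refine le_trans (measure_mono ?_) ((measure_union_le _ _).trans (add_le_add
    (h1.trans (ENNReal.ofReal_le_ofReal (exp_neg_sampleBound_le hlam0 hη hη2)))
    (h2.trans hbound)))
  rintro S ⟨f, hfL, hlt⟩
  by_contra hS
  simp only [Set.mem_union, Set.mem_ofPred_eq, not_or, not_lt, not_and, not_exists] at hS
  obtain ⟨hn, hdev⟩ := hS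
  refine absurd hlt (not_lt.2 ?_)
  have hpos : 0 < sampleBound lam η := (log_inv_pos hη hη2).trans_le
    (log_le_sampleBound hlam0 hη hη2)
  have h3 := excess_le_of_deviation (D := D) (I := longSet L η j m) (τ := 2 * η)
    (s := kept (longSet L η j m) (cap η) (List.ofFn S)) (hf.mem _) hfL
    (fun h0 => by rw [h0, List.length_nil, Nat.cast_zero] at hn; linarith) (hf.min _ f hfL)
    (fun f hfL => hdev hn f hfL)
  rw [localMin, poolExamples_eq_kept]
  refine h3.trans (le_of_eq ?_)
  ring

end LongIntervals

/-! ### Measurability of the local queries -/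

section Measurability

theorem measurable_of_cover {ι α β : Type*} [Countable ι] [MeasurableSpace α]
    [MeasurableSpace β] {f : α → β} (s : ι → Set α) (g : ι → α → β)
    (hs : ∀ i, MeasurableSet (s i)) (hg : ∀ i, Measurable (g i)) (hcover : ∀ x, ∃ i, x ∈ s i)
    (heq : ∀ i, ∀ x ∈ s i, f x = g i x) : Measurable f := by
  intro t ht
  have : f ⁻¹' t = ⋃ i, s i ∩ g i ⁻¹' t := by
    ext x
    simp only [Set.mem_preimage, Set.mem_iUnion, Set.mem_inter_iff]
    constructor
    · intro hx
      obtain ⟨i, hi⟩ := hcover x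
      exact ⟨i, hi, heq i x hi ▸ hx⟩
    · rintro ⟨i, hi, hx⟩
      exact (heq i x hi).symm ▸ hx
  rw [this]
  exact MeasurableSet.iUnion fun i => (hs i).inter (hg i ht)

variable {M : ℕ} {fhat : List Example → unitInterval → unitInterval} {L η : ℝ} {j : ℕ}

/-- The length of the training sample varies with the pool. Once the set of indices of points in the
interval is fixed, the training sample has fixed length and `IsERMRule.meas` applies; there are
finitely many such sets. -/
theorem measurable_localMin (hf : IsERMRule L fhat) (m : ℕ) :
    Measurable fun p : (Fin M → Example) × unitInterval => localMin fhat L η j p.1 m p.2 := by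
  classical
  let lst : Finset (Fin M) → List (Fin M) := fun T =>
    ((List.finRange M).filter fun i => decide (i ∈ T)).take (cap η)
  refine measurable_of_cover (ι := Finset (Fin M))
    (fun T => {p | ∀ i, InLong L η j m (p.1 i).1 ↔ i ∈ T})
    (fun T p => fhat ((lst T).map p.1) p.2) ?_ ?_ ?_ ?_
  · intro T
    simp only [Set.ofPred_forall]
    refine MeasurableSet.iInter fun i => ?_
    have h1 : MeasurableSet {p : (Fin M → Example) × unitInterval | InLong L η j m (p.1 i).1} :=
      (measurable_fst.comp ((measurable_pi_apply i).comp measurable_fst))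
        (measurableSet_inLong L η j m)
    exact h1.iff (MeasurableSet.const _)
  · intro T
    have h1 : Measurable fun p : (Fin M → Example) × unitInterval =>
        ((fun i : Fin (lst T).length => p.1 ((lst T).get i)), p.2) := by fun_prop
    have h2 := (hf.meas (lst T).length).comp h1
    have h3 : ∀ S : Fin M → Example,
        List.ofFn (fun i : Fin (lst T).length => S ((lst T).get i)) = (lst T).map S := by
      intro S
      conv_rhs => rw [← List.ofFn_get (lst T), List.map_ofFn]
      rfl
    simpa only [Function.comp_def, h3] using h2
  · intro p
    exact ⟨Finset.univ.filter fun i => InLong L η j m (p.1 i).1, by simp⟩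
  · intro T p hp
    simp only [localMin, poolExamples, poolIn, lst, cap]
    have h1 : (fun i : Fin M => decide (InLong L η j m (p.1 i).1)) = fun i => decide (i ∈ T) := by
      ext i
      simp only [hp i]
    rw [← h1]

theorem measurable_interp (hf : IsERMRule L fhat) (m : ℕ) :
    Measurable fun p : (Fin M → Example) × unitInterval => interp fhat L η j p.1 m p.2 := by
  have h1 : ∀ m b, Measurable fun p : (Fin M → Example) × unitInterval =>
      evalAt (localMin fhat L η j p.1 m) b := by
    intro m b
    exact measurable_subtype_coe.comp ((measurable_localMin hf m).comp
      (measurable_fst.prodMk measurable_const))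
  have h2 := h1 m (breakpoint L η j (2 * m + 1))
  have h3 := h1 (m + 1) (breakpoint L η j (2 * m + 2))
  unfold interp
  by_cases hb : breakpoint L η j (2 * m + 2) < 1
  · simp only [if_pos hb]
    fun_prop
  · simpa only [if_neg hb] using h2

theorem measurable_queryValue (hL : 0 < L) (hη : 0 < η) (hj : 1 ≤ j) (hf : IsERMRule L fhat) :
    Measurable fun p : (Fin M → Example) × unitInterval => queryValue fhat L η j p.1 p.2 := by
  refine measurable_of_cover (ι := ℕ ⊕ ℕ)
    (Sum.elim (fun m => {p | InLong L η j m p.2}) fun m => {p | InShort L η j m p.2})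
    (Sum.elim (fun m p => (localMin fhat L η j p.1 m p.2 : ℝ))
      fun m p => interp fhat L η j p.1 m p.2) ?_ ?_ ?_ ?_
  · rintro (m | m)
    · exact measurable_snd (measurableSet_inLong L η j m)
    · exact measurable_snd (measurableSet_inShort L η j m)
  · rintro (m | m)
    · exact measurable_subtype_coe.comp (measurable_localMin hf m)
    · exact measurable_interp hf m
  · intro p
    rcases exists_inLong_or_inShort (j := j) hL hη p.2 with ⟨m, h⟩ | ⟨m, h⟩
    · exact ⟨Sum.inl m, h⟩
    · exact ⟨Sum.inr m, h⟩
  · rintro (m | m) p hp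
    · exact queryValue_of_inLong hL hη hj hp
    · exact queryValue_of_inShort hL hη hj hp

end Measurability

/-! ### The prediction error of the function computed by the local queries -/

section ExcessError

variable {M : ℕ} {fhat : List Example → unitInterval → unitInterval} {L η : ℝ} {j : ℕ}
  {D : Measure Example} {S : Fin M → Example}

theorem err_eq (D : Measure Example) (f : unitInterval → unitInterval) :
    err D f = ∫ z, loss f z ∂D := rfl

theorem bddBelow_err (D : Measure Example) (L : ℝ) : BddBelow (err D '' lipClass L) :=
  ⟨0, by rintro _ ⟨f, -, rfl⟩; exact integral_nonneg fun z => abs_nonneg _⟩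

theorem lipClass_nonempty (L : ℝ) : (lipClass L).Nonempty := ⟨fun _ => 0, LipschitzWith.const' 0⟩

/-- The examples that lie outside all long intervals. -/
def offLong (L η : ℝ) (j : ℕ) : Set Example := {z | ¬ ∃ m, InLong L η j m z.1}

theorem measurableSet_offLong (L η : ℝ) (j : ℕ) : MeasurableSet (offLong L η j) := by
  have : offLong L η j = (⋃ m, longSet L η j m)ᶜ := by
    ext z
    simp [offLong, longSet]
  rw [this]
  exact (MeasurableSet.iUnion fun m => measurableSet_longSet L η j m).compl

theorem pairwise_disjoint_longSet (hL : 0 < L) (hη : 0 < η) (hj : 1 ≤ j) :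
    Pairwise (Function.onFun Disjoint (longSet L η j)) := by
  intro m m' hne
  refine Set.disjoint_left.2 fun z hz hz' => hne (InLong.unique hL hη hj hz hz')

theorem sum_longSet_le_one [IsProbabilityMeasure D] (hL : 0 < L) (hη : 0 < η) (hj : 1 ≤ j)
    (s : Finset ℕ) : ∑ m ∈ s, D.real (longSet L η j m) ≤ 1 := by
  rw [← measureReal_biUnion_finset
    (fun m _ m' _ h => pairwise_disjoint_longSet hL hη hj h)
    fun m _ => measurableSet_longSet L η j m]
  exact measureReal_le_one

/-- The average over the offsets of the mass outside the long intervals is small. -/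
theorem sum_offLong_le_one [IsProbabilityMeasure D] (hL : 0 < L) (hη : 0 < η) :
    ∑ j ∈ Finset.Icc 1 ⌊1 / η⌋₊, D.real (offLong L η j) ≤ 1 := by
  rw [← measureReal_biUnion_finset ?_ fun j _ => measurableSet_offLong L η j]
  · exact measureReal_le_one
  · intro j hj j' hj' hne
    simp only [Finset.coe_Icc, Set.mem_Icc, Nat.le_floor_iff (show 0 ≤ 1 / η by positivity)]
      at hj hj'
    exact Set.disjoint_left.2 fun z hz hz' =>
      hne (offset_unique hL hη hj.1 hj'.1 hj.2 hj'.2 hz hz')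

/-- The bound holds pointwise: a covered example lies over exactly one long interval, where the
query is the local minimiser, and elsewhere the loss difference is at most 1. -/
theorem err_queryFun_sub_le [IsProbabilityMeasure D] (hL : 0 < L) (hη : 0 < η) (hj : 1 ≤ j)
    (hfhat : ∀ s, fhat s ∈ lipClass L) {f : unitInterval → unitInterval} (hf : f ∈ lipClass L) :
    err D (queryFun fhat L η j S) - err D f ≤ D.real (offLong L η j) +
      ∑ m ∈ Finset.range ⌈L * η + 1⌉₊,
        ∫ z in longSet L η j m, (loss (localMin fhat L η j S m) z - loss f z) ∂D := by
  classical
  have hq := queryFun_mem_lipClass (fhat := fhat) (S := S) hL hη hj hfhat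
  have hint : ∀ m, Integrable (fun z => loss (localMin fhat L η j S m) z - loss f z) D :=
    fun m => (integrable_loss (hfhat _)).sub (integrable_loss hf)
  have hone : Integrable ((offLong L η j).indicator (1 : Example → ℝ)) D :=
    (integrable_const (1 : ℝ)).indicator (measurableSet_offLong L η j)
  rw [err_eq, err_eq, ← integral_sub (integrable_loss hq) (integrable_loss hf),
    ← integral_indicator_one (measurableSet_offLong L η j)]
  simp_rw [← integral_indicator (measurableSet_longSet L η j _)]
  rw [← integral_finsetSum _ fun m _ => (hint m).indicator (measurableSet_longSet L η j m),
    ← integral_add hone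
      (integrable_finsetSum _ fun m _ => (hint m).indicator (measurableSet_longSet L η j m))]
  refine integral_mono ((integrable_loss hq).sub (integrable_loss hf))
    (hone.add
      (integrable_finsetSum _ fun m _ =>
        (hint m).indicator (measurableSet_longSet L η j m))) fun z => ?_
  by_cases hz : ∃ m, InLong L η j m z.1
  · obtain ⟨m, hm⟩ := hz
    have h1 : z ∉ offLong L η j := fun h => h ⟨m, hm⟩
    have h2 : m ∈ Finset.range ⌈L * η + 1⌉₊ :=
      Finset.mem_range.2 (Nat.lt_ceil.2 (lt_of_breakpoint_lt_one hL hη hm.1))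
    simp only [Set.indicator_of_notMem h1, zero_add]
    have h3 : ∀ m' ≠ m, z ∉ longSet L η j m' := fun m' hne h =>
      hne (InLong.unique hL hη hj h hm)
    rw [Finset.sum_eq_single_of_mem m h2 fun m' _ hne => Set.indicator_of_notMem (h3 m' hne) _,
      Set.indicator_of_mem (show z ∈ longSet L η j m from hm)]
    simp only [loss, coe_queryFun hL hη hj, queryValue_of_inLong hL hη hj hm, le_refl]
  · have h1 : z ∈ offLong L η j := hz
    simp only [Set.indicator_of_mem h1]
    have h3 : ∀ m, z ∉ longSet L η j m := fun m h => hz ⟨m, h⟩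
    rw [Finset.sum_eq_zero fun m _ => Set.indicator_of_notMem (h3 m) _]
    simp only [Pi.one_apply, add_zero]
    linarith [(loss_mem (queryFun fhat L η j S) z).2, (loss_mem f z).1]

open Classical in
/-- The long intervals that are not negligible. -/
noncomputable def heavy (L η : ℝ) (j : ℕ) (D : Measure Example) : Finset ℕ :=
  (Finset.range ⌈L * η + 1⌉₊).filter fun m => η / (L * η + 2) ≤ D.real (longSet L η j m)

/-- An upper bound for the part of the excess error that is small only on average. -/
noncomputable def randomExcess (fhat : List Example → unitInterval → unitInterval) (L η : ℝ)
    (j : ℕ) (D : Measure Example) {M : ℕ} (S : Fin M → Example) : ℝ :=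
  D.real (offLong L η j) + ∑ m ∈ heavy L η j D, D.real (longSet L η j m) *
    (toMeasurable (Measure.pi fun _ : Fin M => D) (badPools fhat L η j D M m)).indicator 1 S

/-- The constant 21 is 20 from successful learning plus 1 from all light intervals together. Heavy
intervals with a bad pool pay their full mass, which goes into `randomExcess`. -/
theorem err_queryFun_le [IsProbabilityMeasure D] (hL : 0 < L) (hη : 0 < η) (hj : 1 ≤ j)
    (hfhat : ∀ s, fhat s ∈ lipClass L) {f : unitInterval → unitInterval} (hf : f ∈ lipClass L) :
    err D (queryFun fhat L η j S) ≤ err D f + 21 * η + randomExcess fhat L η j D S := by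
  classical
  have h1 := err_queryFun_sub_le (S := S) (D := D) hL hη hj hfhat hf
  set R := Finset.range ⌈L * η + 1⌉₊ with hR
  -- A bad pool is defined by an uncountable union over competitors. The measurable hull has the
  -- same measure and can be integrated.
  set B := fun m => toMeasurable (Measure.pi fun _ : Fin M => D) (badPools fhat L η j D M m)
  set low := η / (L * η + 2) with hlow
  have hlow0 : 0 < low := by positivity
  have hterm : ∀ m, (∫ z in longSet L η j m, (loss (localMin fhat L η j S m) z - loss f z) ∂D) ≤
      20 * η * D.real (longSet L η j m) + (low + if low ≤ D.real (longSet L η j m) then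
        D.real (longSet L η j m) * (B m).indicator 1 S else 0) := by
    intro m
    have hP : 0 ≤ D.real (longSet L η j m) := measureReal_nonneg
    have htriv : (∫ z in longSet L η j m, (loss (localMin fhat L η j S m) z - loss f z) ∂D) ≤
        D.real (longSet L η j m) := by
      have := norm_setIntegral_le_of_norm_le_const (μ := D) (s := longSet L η j m) (C := 1)
        (f := fun z => loss (localMin fhat L η j S m) z - loss f z) (measure_lt_top _ _)
        fun z _ => by
          rw [Real.norm_eq_abs]
          exact (abs_sub_mem_Icc (loss_mem _ z) (loss_mem f z)).2
      rw [one_mul] at this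
      exact (le_abs_self _).trans this
    have h20 : 0 ≤ 20 * η * D.real (longSet L η j m) := by positivity
    split_ifs with hh
    · by_cases hS : S ∈ B m
      · rw [Set.indicator_of_mem hS, Pi.one_apply]
        linarith
      · rw [Set.indicator_of_notMem hS]
        have : S ∉ badPools fhat L η j D M m := fun h => hS (subset_toMeasurable _ _ h)
        simp only [badPools, Set.mem_ofPred_eq, not_exists, not_and, not_lt] at this
        linarith [this f hf]
    · linarith
  have h2 := Finset.sum_le_sum fun m (_ : m ∈ R) => hterm m
  rw [Finset.sum_add_distrib, Finset.sum_add_distrib, ← Finset.mul_sum, Finset.sum_const,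
    ← Finset.sum_filter, nsmul_eq_mul, hR, Finset.card_range, ← hR] at h2
  have h3 := sum_longSet_le_one (D := D) hL hη hj R
  have h4 : (⌈L * η + 1⌉₊ : ℝ) * low ≤ η := by
    have := (Nat.ceil_lt_add_one (show 0 ≤ L * η + 1 by positivity)).le
    calc (⌈L * η + 1⌉₊ : ℝ) * low ≤ (L * η + 1 + 1) * low := by gcongr
      _ = η := by rw [hlow]; field_simp; ring
  have h5 := mul_le_mul_of_nonneg_left h3 (show 0 ≤ 20 * η by positivity)
  simp only [randomExcess, heavy]
  linarith

/-- The lower bound on M gives every heavy interval the expected number of points that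
`measure_badPools_le` requires. Each is then bad with probability at most 2η, and their masses sum
to at most 1. -/
theorem integral_randomExcess_le [IsProbabilityMeasure D] (hL : 0 < L) (hη : 0 < η)
    (hη2 : η ≤ 1 / 2) (hj : 1 ≤ j) (hjη : (j : ℝ) ≤ 1 / η) (hf : IsERMRule L fhat)
    (hM : 4 * sampleBound (min L (1 / η)) η * (L * η + 2) / η ≤ M) :
    Integrable (randomExcess fhat L η j D (M := M)) (Measure.pi fun _ : Fin M => D) ∧
    ∫ S, randomExcess fhat L η j D S ∂(Measure.pi fun _ : Fin M => D) ≤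
      D.real (offLong L η j) + 2 * η := by
  set P := Measure.pi fun _ : Fin M => D
  set B := fun m => toMeasurable P (badPools fhat L η j D M m) with hB
  have hBm : ∀ m, MeasurableSet (B m) := fun m => measurableSet_toMeasurable _ _
  have hint : ∀ m, Integrable (fun S => D.real (longSet L η j m) *
      (B m).indicator (1 : (Fin M → Example) → ℝ) S) P := fun m =>
    ((integrable_const (1 : ℝ)).indicator (hBm m)).const_mul _
  have hsum : Integrable (fun S => ∑ m ∈ heavy L η j D, D.real (longSet L η j m) *
      (B m).indicator (1 : (Fin M → Example) → ℝ) S) P :=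
    integrable_finsetSum _ fun m _ => hint m
  refine ⟨(integrable_const _).add hsum, ?_⟩
  have e : ∫ S, randomExcess fhat L η j D S ∂P = D.real (offLong L η j) +
      ∑ m ∈ heavy L η j D, D.real (longSet L η j m) * P.real (B m) := by
    unfold randomExcess
    rw [integral_add (integrable_const _) hsum, integral_finsetSum _ fun m _ => hint m]
    simp only [integral_const, probReal_univ, one_smul, integral_const_mul]
    congr 1
    refine Finset.sum_congr rfl fun m _ => ?_
    rw [integral_indicator_one (hBm m)]
  rw [e]
  have hbad : ∀ m ∈ heavy L η j D, P.real (B m) ≤ 2 * η := by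
    intro m hm
    rw [Measure.real, hB, measure_toMeasurable]
    refine ENNReal.toReal_le_of_le_ofReal (by positivity)
      (measure_badPools_le hL hη hη2 hj hjη hf ?_)
    have h1 : η / (L * η + 2) ≤ D.real (longSet L η j m) := by
      classical
      exact (Finset.mem_filter.1 hm).2
    have hpos : 0 < sampleBound (min L (1 / η)) η := (log_inv_pos hη hη2).trans_le
      (log_le_sampleBound (le_min hL.le (by positivity)) hη hη2)
    calc 4 * sampleBound (min L (1 / η)) η
        = 4 * sampleBound (min L (1 / η)) η * (L * η + 2) / η * (η / (L * η + 2)) := by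
          field_simp
      _ ≤ _ := by gcongr
  gcongr
  calc ∑ m ∈ heavy L η j D, D.real (longSet L η j m) * P.real (B m)
      ≤ ∑ m ∈ heavy L η j D, D.real (longSet L η j m) * (2 * η) :=
        Finset.sum_le_sum fun m hm => mul_le_mul_of_nonneg_left (hbad m hm) measureReal_nonneg
    _ ≤ 1 * (2 * η) := by
        rw [← Finset.sum_mul]
        exact mul_le_mul_of_nonneg_right (sum_longSet_le_one hL hη hj _) (by positivity)
    _ = 2 * η := one_mul _

/-- The local queries compute a nearly optimal function unless the random excess is large. -/
theorem abs_err_queryFun_sub_optErr_le [IsProbabilityMeasure D] (hL : 0 < L) (hη : 0 < η)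
    (hj : 1 ≤ j) (hfhat : ∀ s, fhat s ∈ lipClass L) :
    |err D (queryFun fhat L η j S) - optErr D L| ≤ 21 * η + randomExcess fhat L η j D S := by
  have h1 : optErr D L ≤ err D (queryFun fhat L η j S) :=
    csInf_le (bddBelow_err D L) ⟨_, queryFun_mem_lipClass hL hη hj hfhat, rfl⟩
  have h2 : err D (queryFun fhat L η j S) - (21 * η + randomExcess fhat L η j D S) ≤
      optErr D L := by
    refine le_csInf ((lipClass_nonempty L).image _) ?_
    rintro _ ⟨f, hf, rfl⟩
    linarith [err_queryFun_le (S := S) (D := D) hL hη hj hfhat hf]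
  rw [abs_of_nonneg (by linarith)]
  linarith

end ExcessError

/-! ### The failure probability -/

section Failure

variable {M N : ℕ} {fhat : List Example → unitInterval → unitInterval} {L η ε : ℝ} {j : ℕ}
  {D : Measure Example}

theorem measurable_loss_queryFun (hL : 0 < L) (hη : 0 < η) (hj : 1 ≤ j)
    (hf : IsERMRule L fhat) :
    Measurable fun p : (Fin M → Example) × Example => loss (queryFun fhat L η j p.1) p.2 := by
  have h1 : Measurable fun p : (Fin M → Example) × Example =>
      queryValue fhat L η j p.1 p.2.1 :=
    (measurable_queryValue hL hη hj hf).comp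
      (measurable_fst.prodMk (measurable_fst.comp measurable_snd))
  simp only [loss, coe_queryFun hL hη hj]
  simp_rw [← Real.norm_eq_abs]
  fun_prop

/-- The fresh examples give a good estimate of the error of the local queries. -/
theorem measure_fresh_deviation_le [IsProbabilityMeasure D] (hL : 0 < L) (hη : 0 < η)
    (hj : 1 ≤ j) (hf : IsERMRule L fhat) (hε : 0 < ε) (hN : 8 / ε ^ 2 ≤ N) :
    ((Measure.pi fun _ : Fin M => D).prod (Measure.pi fun _ : Fin N => D))
      {p | ε / 2 ≤ |errorOutput fhat L η (j, p) - err D (queryFun fhat L η j p.1)|} ≤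
    ENNReal.ofReal (1 / 8) := by
  have hN0 : (0 : ℝ) < N := lt_of_lt_of_le (by positivity) hN
  have hout : ∀ p : (Fin M → Example) × (Fin N → Example), errorOutput fhat L η (j, p) =
      1 / (N : ℝ) * ∑ i, loss (queryFun fhat L η j p.1) (p.2 i) := by
    intro p
    rw [show (j, p) = (j, p.1, p.2) from rfl, errorOutput_eq]
    simp only [loss, coe_queryFun hL hη hj]
    congr 1
    exact Finset.sum_congr rfl fun i _ => abs_sub_comm _ _
  simp_rw [hout]
  have hl := measurable_loss_queryFun (M := M) hL hη hj hf
  have m1 : Measurable fun p : (Fin M → Example) × (Fin N → Example) =>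
      1 / (N : ℝ) * ∑ i, loss (queryFun fhat L η j p.1) (p.2 i) := by
    refine (Finset.measurable_sum _ fun i _ => ?_).const_mul _
    exact hl.comp (measurable_fst.prodMk ((measurable_pi_apply i).comp measurable_snd))
  have m2 : Measurable fun p : (Fin M → Example) × (Fin N → Example) =>
      err D (queryFun fhat L η j p.1) := by
    have : Measurable fun S : Fin M → Example => err D (queryFun fhat L η j S) := by
      simp_rw [err_eq]
      exact (hl.stronglyMeasurable.integral_prod_right (ν := D)).measurable
    exact this.comp measurable_fst
  have hmeas : MeasurableSet {p : (Fin M → Example) × (Fin N → Example) | ε / 2 ≤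
      |1 / (N : ℝ) * ∑ i, loss (queryFun fhat L η j p.1) (p.2 i) -
        err D (queryFun fhat L η j p.1)|} := by
    simp_rw [← Real.norm_eq_abs]
    exact measurableSet_le measurable_const (m1.sub m2).norm
  rw [Measure.prod_apply hmeas]
  have hslice : ∀ S : Fin M → Example, (Measure.pi fun _ : Fin N => D) (Prod.mk S ⁻¹'
      {p : (Fin M → Example) × (Fin N → Example) | ε / 2 ≤
      |1 / (N : ℝ) * ∑ i, loss (queryFun fhat L η j p.1) (p.2 i) -
        err D (queryFun fhat L η j p.1)|}) ≤ ENNReal.ofReal (1 / 8) := by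
    intro S
    have hq := queryFun_mem_lipClass (S := S) hL hη hj hf.mem
    -- For a fixed pool the queried function is fixed and independent of the fresh examples, so no
    -- union bound is needed.
    have h1 := measure_abs_deviation_le (D := D) MeasurableSet.univ (measurable_loss hq)
      (loss_mem _) (τ := ε / 2) (by positivity) N N N
    refine le_trans (measure_mono ?_) (h1.trans ?_)
    · intro T hT
      simp only [Set.mem_preimage, Set.mem_ofPred_eq] at hT ⊢
      rw [kept_univ (by simp), List.length_ofFn, ProbabilityTheory.cond_univ, ← err_eq,
        List.map_ofFn, List.sum_ofFn]
      refine ⟨le_rfl, ?_⟩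
      have e : ∑ i, (loss (queryFun fhat L η j S) ∘ T) i - N * err D (queryFun fhat L η j S) =
          N * (1 / (N : ℝ) * ∑ i, loss (queryFun fhat L η j S) (T i) -
            err D (queryFun fhat L η j S)) := by
        simp only [Function.comp_apply]
        field_simp
      rw [e, abs_mul, abs_of_pos hN0, mul_comm]
      gcongr
    · rw [show (2 : ENNReal) = ENNReal.ofReal 2 by simp, ← ENNReal.ofReal_mul (by norm_num)]
      refine ENNReal.ofReal_le_ofReal ?_
      have h4 : 4 ≤ 2 * (ε / 2) ^ 2 * N := by
        rw [div_le_iff₀ (by positivity)] at hN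
        linarith
      have h16 : (16 : ℝ) ≤ Real.exp 4 := by
        have h2 : (2 : ℝ) ≤ Real.exp 1 := by linarith [Real.add_one_le_exp (1 : ℝ)]
        calc (16 : ℝ) = 2 ^ 4 := by norm_num
          _ ≤ Real.exp 1 ^ 4 := by gcongr
          _ = Real.exp 4 := by rw [← Real.exp_nat_mul]; norm_num
      calc 2 * Real.exp (-(2 * (ε / 2) ^ 2 * N)) ≤ 2 * Real.exp (-4) := by gcongr
        _ ≤ 2 * (1 / 16) := by
            rw [Real.exp_neg, ← one_div]
            gcongr
        _ = 1 / 8 := by norm_num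
  calc _ ≤ ∫⁻ _ : Fin M → Example, ENNReal.ofReal (1 / 8) ∂(Measure.pi fun _ => D) :=
        lintegral_mono hslice
    _ = ENNReal.ofReal (1 / 8) := by simp

/-- The failure probability for a fixed offset. -/
theorem measure_failure_le [IsProbabilityMeasure D] (hL : 0 < L) (hε : 0 < ε)
    (hη : 0 < η) (hηε : 84 * η ≤ ε) (hη2 : η ≤ 1 / 2) (hj : 1 ≤ j) (hjη : (j : ℝ) ≤ 1 / η)
    (hf : IsERMRule L fhat) (hN : 8 / ε ^ 2 ≤ N)
    (hM : 4 * sampleBound (min L (1 / η)) η * (L * η + 2) / η ≤ M) :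
    ((Measure.pi fun _ : Fin M => D).prod (Measure.pi fun _ : Fin N => D))
      {p | ε < |errorOutput fhat L η (j, p) - optErr D L|} ≤
    ENNReal.ofReal (1 / 8 + 4 / ε * (D.real (offLong L η j) + 2 * η)) := by
  obtain ⟨hint, hle⟩ := integral_randomExcess_le (D := D) hL hη hη2 hj hjη hf hM
  have hoff : 0 ≤ D.real (offLong L η j) := measureReal_nonneg
  -- Markov's inequality at ε/4. The error budget is ε/2 for the fresh sample, ε/4 for the random
  -- excess, and 21η ≤ ε/4, which is where 84 comes from.
  have hmk := mul_meas_ge_le_integral_of_nonneg (Filter.Eventually.of_forall fun S => by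
    unfold randomExcess
    refine add_nonneg hoff (Finset.sum_nonneg fun m _ => mul_nonneg measureReal_nonneg ?_)
    exact Set.indicator_nonneg (fun _ _ => zero_le_one) _) hint (ε / 4)
  have h1 : (Measure.pi fun _ : Fin M => D) {S | ε / 4 ≤ randomExcess fhat L η j D S} ≤
      ENNReal.ofReal (4 / ε * (D.real (offLong L η j) + 2 * η)) := by
    rw [← ENNReal.ofReal_toReal (measure_ne_top _ _)]
    refine ENNReal.ofReal_le_ofReal ?_
    rw [← Measure.real, show 4 / ε * (D.real (offLong L η j) + 2 * η) =
      (D.real (offLong L η j) + 2 * η) / (ε / 4) by field_simp, le_div_iff₀ (by positivity),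
      mul_comm]
    exact hmk.trans hle
  rw [ENNReal.ofReal_add (by norm_num) (by positivity)]
  refine le_trans (measure_mono ?_) ((measure_union_le _
    ({S | ε / 4 ≤ randomExcess fhat L η j D S} ×ˢ Set.univ)).trans
    (add_le_add (measure_fresh_deviation_le hL hη hj hf hε hN) ?_))
  · rintro p hp
    by_contra hcon
    simp only [Set.mem_union, Set.mem_prod, Set.mem_univ, and_true, Set.mem_ofPred_eq, not_or,
      not_le] at hcon hp
    have h2 := abs_err_queryFun_sub_optErr_le (D := D) (S := p.1) hL hη hj hf.mem
    have h3 := abs_sub_le (errorOutput fhat L η (j, p)) (err D (queryFun fhat L η j p.1))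
      (optErr D L)
    linarith [hcon.1, hcon.2]
  · rw [Measure.prod_prod, measure_univ, mul_one]
    exact h1

/-- The upper bound needs no measurability of A: ℕ is countable and discrete, so each slice can be
replaced by its measurable hull. -/
theorem measure_prod_le_lintegral {Z : Type*} [MeasurableSpace Z] (U : Measure ℕ)
    (ν : Measure Z) [SFinite U] [SFinite ν] (A : Set (ℕ × Z)) :
    (U.prod ν) A ≤ ∫⁻ j, ν (Prod.mk j ⁻¹' A) ∂U := by
  set B : Set (ℕ × Z) := ⋃ j, {j} ×ˢ toMeasurable ν (Prod.mk j ⁻¹' A) with hB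
  have hBm : MeasurableSet B := MeasurableSet.iUnion fun j =>
    (measurableSet_singleton j).prod (measurableSet_toMeasurable _ _)
  have hAB : A ⊆ B := fun p hp => Set.mem_iUnion.2 ⟨p.1, rfl, subset_toMeasurable _ _ hp⟩
  have hslice : ∀ j, Prod.mk j ⁻¹' B = toMeasurable ν (Prod.mk j ⁻¹' A) := by
    intro j
    ext z
    simp [hB]
  calc (U.prod ν) A ≤ (U.prod ν) B := measure_mono hAB
    _ = ∫⁻ j, ν (Prod.mk j ⁻¹' A) ∂U := by
        rw [Measure.prod_apply hBm]
        simp_rw [hslice, measure_toMeasurable]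

theorem lintegral_uniformOn_Icc (n : ℕ) (g : ℕ → ENNReal) :
    ∫⁻ j, g j ∂(ProbabilityTheory.uniformOn (Set.Icc 1 n)) =
      (n : ENNReal)⁻¹ * ∑ j ∈ Finset.Icc 1 n, g j := by
  rw [ProbabilityTheory.uniformOn, ProbabilityTheory.cond, lintegral_smul_measure,
    ← Finset.coe_Icc, lintegral_finset, Measure.count_apply_finset]
  simp

/-- Averaging over the offset turns the uncovered mass into at most 1/n ≤ 2η, so failure has
probability at most 1/8 + (4/ε)(2η + 2η) = 1/8 + 16η/ε ≤ 1/4. -/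
theorem half_le_measure_success [IsProbabilityMeasure D] (hL : 0 < L) (hε : 0 < ε)
    (hη : 0 < η) (hηε : 128 * η ≤ ε) (hη2 : η ≤ 1 / 2)
    (hf : IsERMRule L fhat) (hN : 8 / ε ^ 2 ≤ N)
    (hM : 4 * sampleBound (min L (1 / η)) η * (L * η + 2) / η ≤ M) :
    1 / 2 ≤ outcomeMeasure D η M N {w | |errorOutput fhat L η w - optErr D L| ≤ ε} := by
  set n := ⌊1 / η⌋₊ with hn
  have hinv : 2 ≤ 1 / η := by rw [le_div_iff₀ hη]; linarith
  have hn1 : 1 ≤ n := Nat.le_floor (by push_cast; linarith)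
  have hn0 : (0 : ℝ) < n := by exact_mod_cast hn1
  have : IsProbabilityMeasure (ProbabilityTheory.uniformOn (Set.Icc 1 n)) :=
    ProbabilityTheory.isProbabilityMeasure_uniformOn (Set.finite_Icc 1 n) ⟨1, le_rfl, hn1⟩
  have hprob : IsProbabilityMeasure (outcomeMeasure D η M N) := by
    unfold outcomeMeasure
    infer_instance
  have hn2 : 1 / (n : ℝ) ≤ 2 * η := by
    have h1 := Nat.lt_floor_add_one (1 / η)
    rw [← hn] at h1
    rw [div_le_iff₀ hn0]
    have h2 : 1 / η / 2 ≤ n := by linarith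
    calc (1 : ℝ) = 2 * η * (1 / η / 2) := by field_simp
      _ ≤ 2 * η * n := by gcongr
  have hfail : outcomeMeasure D η M N {w | |errorOutput fhat L η w - optErr D L| ≤ ε}ᶜ ≤
      ENNReal.ofReal (1 / 2) := by
    have hset : {w : Outcome M N | |errorOutput fhat L η w - optErr D L| ≤ ε}ᶜ =
        {w | ε < |errorOutput fhat L η w - optErr D L|} := by
      ext w
      simp
    rw [hset]
    refine (measure_prod_le_lintegral _ _ _).trans ?_
    rw [lintegral_uniformOn_Icc]
    calc (n : ENNReal)⁻¹ * ∑ j ∈ Finset.Icc 1 n,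
          ((Measure.pi fun _ : Fin M => D).prod (Measure.pi fun _ : Fin N => D))
            (Prod.mk j ⁻¹' {w | ε < |errorOutput fhat L η w - optErr D L|})
        ≤ (n : ENNReal)⁻¹ * ∑ j ∈ Finset.Icc 1 n,
          ENNReal.ofReal (1 / 8 + 4 / ε * (D.real (offLong L η j) + 2 * η)) := by
          gcongr with j hj
          rw [Finset.mem_Icc] at hj
          exact measure_failure_le hL hε hη (by linarith) hη2 hj.1
            ((Nat.le_floor_iff (by positivity)).1 hj.2) hf hN hM
      _ = ENNReal.ofReal (1 / n * ∑ j ∈ Finset.Icc 1 n,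
            (1 / 8 + 4 / ε * (D.real (offLong L η j) + 2 * η))) := by
          rw [ENNReal.ofReal_mul (by positivity), ENNReal.ofReal_sum_of_nonneg fun j _ => by
            have : 0 ≤ D.real (offLong L η j) := measureReal_nonneg
            positivity, one_div (n : ℝ), ENNReal.ofReal_inv_of_pos hn0, ENNReal.ofReal_natCast]
      _ ≤ ENNReal.ofReal (1 / 2) := by
          refine ENNReal.ofReal_le_ofReal ?_
          have hs := sum_offLong_le_one (D := D) hL hη
          rw [← hn] at hs
          rw [Finset.sum_add_distrib, ← Finset.mul_sum, Finset.sum_add_distrib,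
            Finset.sum_const, Finset.sum_const, Nat.card_Icc, Nat.add_sub_cancel, nsmul_eq_mul,
            nsmul_eq_mul]
          have hηε' : η / ε ≤ 1 / 128 := by rw [div_le_iff₀ hε]; linarith
          calc _ = 1 / 8 + 4 / ε * (1 / n * ∑ j ∈ Finset.Icc 1 n, D.real (offLong L η j)) +
                8 * (η / ε) := by field_simp; ring
            _ ≤ 1 / 8 + 4 / ε * (2 * η * 1) + 8 * (η / ε) := by gcongr
            _ = 1 / 8 + 16 * (η / ε) := by field_simp; ring
            _ ≤ 1 / 2 := by linarith
  -- Subadditivity alone passes from the failure event to the success event, which is not known to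
  -- be measurable.
  have h1 := measure_univ_le_add_compl (μ := outcomeMeasure D η M N)
    {w | |errorOutput fhat L η w - optErr D L| ≤ ε}
  rw [measure_univ] at h1
  have h3 : ENNReal.ofReal (1 / 2) = 1 / 2 := by
    rw [ENNReal.ofReal_div_of_pos (by norm_num)]
    simp
  rw [h3] at hfail
  have h2 : (1 : ENNReal) / 2 + 1 / 2 ≤ outcomeMeasure D η M N
      {w | |errorOutput fhat L η w - optErr D L| ≤ ε} + 1 / 2 := by
    rw [ENNReal.add_halves]
    exact h1.trans (by gcongr)
  exact (ENNReal.add_le_add_iff_right (by simp)).1 h2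

end Failure

/-! ### The numbers of examples and labels -/

section Sizes

variable {L ε : ℝ}

theorem log_two_div_ge (hε : 0 < ε) (hε1 : ε ≤ 1) : 3 / 5 ≤ Real.log (2 / ε) := by
  calc (3 / 5 : ℝ) ≤ Real.log 2 := by linarith [Real.log_two_gt_d9]
    _ ≤ Real.log (2 / ε) := by
        gcongr
        rw [le_div_iff₀ hε]
        linarith

/-- Since 128 = 2^7 and ε ≤ 1, 128/ε ≤ (2/ε)^7. -/
theorem log_inv_scaled_le (hε : 0 < ε) (hε1 : ε ≤ 1) :
    Real.log (1 / (1 / 128 * ε)) ≤ 7 * Real.log (2 / ε) := by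
  rw [show (7 : ℝ) = (7 : ℕ) by norm_num, ← Real.log_pow]
  gcongr
  have h1 : ε ^ 7 ≤ ε := pow_le_of_le_one hε.le hε1 (by norm_num)
  rw [div_pow, div_le_div_iff₀ (by positivity) (by positivity)]
  linarith

/-- Points per interval times number of intervals is of order L/η in both regimes: one strip
parameter L and boundedly many intervals, or strip parameter 1/η and about Lη intervals. The
additive constants account for `max L η`. -/
theorem strip_mul_le {η : ℝ} (hL : 0 < L) (hη : 0 < η) (hη2 : η ≤ 1 / 2) :
    (min L (1 / η) / (2 * η) + 3) * (L * η + 2) ≤ 11 * (max L η / η) := by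
  rcases le_total L (1 / η) with h | h
  · have hLη : L * η ≤ 1 := by rwa [le_div_iff₀ hη] at h
    rw [min_eq_left h]
    have h1 : L / η ≤ max L η / η := by gcongr; exact le_max_left _ _
    have h2 : 1 ≤ max L η / η := by rw [le_div_iff₀ hη, one_mul]; exact le_max_right _ _
    calc (L / (2 * η) + 3) * (L * η + 2) ≤ (L / (2 * η) + 3) * (1 + 2) := by gcongr
      _ = 3 / 2 * (L / η) + 9 := by field_simp; ring
      _ ≤ 11 * (max L η / η) := by linarith
  · have hLη : 1 ≤ L * η := by rwa [div_le_iff₀ hη] at h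
    rw [min_eq_right h]
    have h1 : L / η ≤ max L η / η := by gcongr; exact le_max_left _ _
    have h3 : 1 ≤ 1 / η ^ 2 := by rw [le_div_iff₀ (by positivity)]; nlinarith
    calc (1 / η / (2 * η) + 3) * (L * η + 2) = (1 / 2 * (1 / η ^ 2) + 3) * (L * η + 2) := by
          field_simp
      _ ≤ (1 / 2 * (1 / η ^ 2) + 3 * (1 / η ^ 2)) * (L * η + 2 * (L * η)) := by
          gcongr <;> linarith
      _ = 21 / 2 * (L / η) := by field_simp; ring
      _ ≤ 11 * (max L η / η) := by
          have : 0 ≤ L / η := by positivity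
          linarith

theorem poolSize_le (hL : 0 < L) (hε : 0 < ε) (hε1 : ε ≤ 1) :
    (⌈4 * sampleBound (min L (1 / (1 / 128 * ε))) (1 / 128 * ε) * (L * (1 / 128 * ε) + 2) /
      (1 / 128 * ε)⌉₊ : ℝ) ≤ 10 ^ 11 * (max L ε / ε ^ 4 * Real.log (2 / ε)) := by
  set η := 1 / 128 * ε with hη'
  have hη : 0 < η := by positivity
  have hη2 : η ≤ 1 / 2 := by linarith
  have hlog := log_two_div_ge hε hε1
  have hlog1 := log_inv_pos hη hη2
  have hlog2 : Real.log (1 / η) ≤ 7 * Real.log (2 / ε) := log_inv_scaled_le hε hε1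
  have hmax : max L η ≤ max L ε := max_le_max le_rfl (by linarith)
  have hmin : 0 < min L (1 / η) := lt_min hL (by positivity)
  have hmpos : 0 < max L ε := lt_max_of_lt_left hL
  -- This absorbs the 1 lost in rounding up to an integer.
  have hone : 1 ≤ 2 * (max L ε / ε ^ 4 * Real.log (2 / ε)) := by
    have h1 : 1 ≤ max L ε / ε ^ 4 := by
      rw [le_div_iff₀ (by positivity), one_mul]
      exact (pow_le_of_le_one hε.le hε1 (by norm_num)).trans (le_max_right _ _)
    nlinarith
  have hval : 4 * sampleBound (min L (1 / η)) η * (L * η + 2) / η ≤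
      77 / 2 * 128 ^ 4 * (max L ε / ε ^ 4 * Real.log (2 / ε)) := by
    calc 4 * sampleBound (min L (1 / η)) η * (L * η + 2) / η
        = (min L (1 / η) / (2 * η) + 3) * (L * η + 2) * Real.log (1 / η) / (2 * η ^ 3) := by
          rw [sampleBound]
          field_simp
          ring
      _ ≤ 11 * (max L ε / η) * (7 * Real.log (2 / ε)) / (2 * η ^ 3) := by
          have h1 := strip_mul_le hL hη hη2
          have h2 : 11 * (max L η / η) ≤ 11 * (max L ε / η) := by gcongr
          refine div_le_div_of_nonneg_right ?_ (by positivity)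
          exact mul_le_mul (h1.trans h2) hlog2 hlog1.le (by positivity)
      _ = 77 / 2 * 128 ^ 4 * (max L ε / ε ^ 4 * Real.log (2 / ε)) := by
          rw [hη']
          field_simp
          ring
  refine (Nat.ceil_lt_add_one ?_).le.trans ?_
  · have := (log_le_sampleBound hmin.le hη hη2).trans' hlog1.le
    positivity
  · nlinarith

theorem freshSize_le (hε : 0 < ε) (hε1 : ε ≤ 1) : (⌈8 / ε ^ 2⌉₊ : ℝ) ≤ 9 * (1 / ε ^ 2) := by
  have h1 : 1 ≤ 1 / ε ^ 2 := by
    rw [le_div_iff₀ (by positivity)]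
    nlinarith
  have h2 := (Nat.ceil_lt_add_one (show 0 ≤ 8 / ε ^ 2 by positivity)).le
  have h3 : 8 / ε ^ 2 = 8 * (1 / ε ^ 2) := by ring
  linarith

theorem labelBound_le (hε : 0 < ε) (hε1 : ε ≤ 1) :
    ((⌈8 / ε ^ 2⌉₊ * (2 * cap (1 / 128 * ε)) + ⌈8 / ε ^ 2⌉₊ : ℕ) : ℝ) ≤
      10 ^ 11 * (1 / ε ^ 6 * Real.log (2 / ε)) := by
  set η := 1 / 128 * ε with hη'
  have hη : 0 < η := by positivity
  have hlog := log_two_div_ge hε hε1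
  have hlog1 := log_inv_pos hη (by linarith)
  have hlog2 : Real.log (1 / η) ≤ 7 * Real.log (2 / ε) := log_inv_scaled_le hε hε1
  have hcap : (cap η : ℝ) ≤ 7 / 2 * 128 ^ 4 * (1 / ε ^ 4 * Real.log (2 / ε)) + 1 := by
    rw [cap]
    push_cast
    gcongr
    refine (Nat.floor_le (by positivity)).trans ?_
    calc 1 / (2 * η ^ 4) * Real.log (1 / η) ≤ 1 / (2 * η ^ 4) * (7 * Real.log (2 / ε)) := by
          gcongr
      _ = _ := by rw [hη']; field_simp
  have hone : 1 ≤ 2 * (1 / ε ^ 4 * Real.log (2 / ε)) := by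
    have h1 : 1 ≤ 1 / ε ^ 4 := by
      rw [le_div_iff₀ (by positivity), one_mul]
      exact pow_le_one₀ hε.le hε1
    nlinarith
  have hN := freshSize_le hε hε1
  push_cast
  calc (⌈8 / ε ^ 2⌉₊ : ℝ) * (2 * cap η) + ⌈8 / ε ^ 2⌉₊ = ⌈8 / ε ^ 2⌉₊ * (2 * cap η + 1) := by
        ring
    _ ≤ 9 * (1 / ε ^ 2) * (10 ^ 10 * (1 / ε ^ 4 * Real.log (2 / ε))) := by
        gcongr
        linarith
    _ = 9 * 10 ^ 10 * (1 / ε ^ 6 * Real.log (2 / ε)) := by field_simp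
    _ ≤ 10 ^ 11 * (1 / ε ^ 6 * Real.log (2 / ε)) := by
        gcongr
        norm_num

end Sizes

end LipschitzError

theorem mainTheorem2 :
    ∃ c C : ℝ, 0 < c ∧ c ≤ 1 ∧ 0 < C ∧
      ∀ L ε : ℝ, 0 < L → 0 < ε → ε ≤ 1 →
        ∃ M N : ℕ,
          (M : ℝ) ≤ C * (max L ε / ε ^ 4 * Real.log (2 / ε)) ∧
          (N : ℝ) ≤ C * (1 / ε ^ 2) ∧
          ∀ fhat : List LipschitzError.Example → unitInterval → unitInterval,
            LipschitzError.IsERMRule L fhat →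
              (∀ w : LipschitzError.Outcome M N,
                (LipschitzError.errorLabels fhat L (c * ε) w : ℝ) ≤
                  C * (1 / ε ^ 6 * Real.log (2 / ε))) ∧
              ∀ D : MeasureTheory.Measure LipschitzError.Example,
                MeasureTheory.IsProbabilityMeasure D →
                  1 / 2 ≤ LipschitzError.outcomeMeasure D (c * ε) M N
                    {w | |LipschitzError.errorOutput fhat L (c * ε) w -
                        LipschitzError.optErr D L| ≤ ε} := by
  -- M and N are the least integers allowed by `half_le_measure_success`. The constant 10^11 leaves
  -- room above 77/2 · 128^4, about 1.03 · 10^10, for the pool and above 9 · 10^10 for the labels.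
  refine ⟨1 / 128, 10 ^ 11, by norm_num, by norm_num, by norm_num, fun L ε hL hε hε1 => ?_⟩
  refine ⟨_, _, LipschitzError.poolSize_le hL hε hε1,
    (LipschitzError.freshSize_le hε hε1).trans ?_, fun fhat hf => ⟨fun w => ?_, fun D hD => ?_⟩⟩
  · gcongr
    norm_num
  · exact (Nat.cast_le.2 (LipschitzError.errorLabels_le fhat L _ w)).trans
      (LipschitzError.labelBound_le hε hε1)
  · exact LipschitzError.half_le_measure_success hL hε (by positivity) (by linarith)
      (by linarith) hf (Nat.le_ceil _) (Nat.le_ceil _)
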